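/- For integers $n,k\ge 1$ let $H_n=\sum_{j=1}^n \frac1j$ and $L_n(k)=\sum_{j=1}^n\frac{(-1)^{j-1}}{j^k}$, let $\zeta$ be the Riemann zeta function, and let $$\zeta^\star(q,p)=\sum_{m\ge n\ge1}\frac{1}{m^q n^p}\qquad(q\ge 2,\ p\ge 1),$$ where a bar over $q$ (respectively over $p$) means that an additional factor $(-1)^m$ (respectively $(-1)^n$) is inserted in the summand; for example $\zeta^\star(\bar 4,2)=\sum_{m\ge1}\frac{(-1)^m}{m^4}\sum_{n=1}^m\frac1{n^2}$. Then the following series converge and have the stated values: $$\sum_{n=1}^\infty \frac{H_n^2}{n^4}(-1)^{n-1} = -\frac{175}{32}\zeta(6)+\frac12\zeta(3)^2-\zeta^\star(\bar4,2)-5\,\zeta^\star(\bar5,1),$$ $$\sum_{n=1}^\infty \frac{L_n(1)^2}{n^4} = \frac{15}{4}\zeta(4)\ln^2 2+\frac94\zeta(2)\zeta(3)\ln2-\frac{31}{4}\zeta(5)\ln2+\frac{231}{64}\zeta(6)-\frac{45}{32}\zeta(3)^2+\zeta^\star(\bar5,\bar1)+\zeta^\star(4,\bar2),$$ $$\sum_{n=1}^\infty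 \frac{L_n(1)^2}{n^4}(-1)^{n-1} = \frac{15}{4}\zeta(4)\ln^2 2+\frac94\zeta(2)\zeta(3)\ln2-\frac{93}{16}\zeta(5)\ln2+\frac{35}{64}\zeta(6)-\frac{15}{16}\zeta(3)^2-\zeta^\star(\bar4,2),$$ $$\sum_{n=1}^\infty \frac{H_nL_n(1)}{n^4} = -\frac32\zeta(2)\zeta(3)\ln2+\frac{31}{8}\zeta(5)\ln2+\frac{2359}{384}\zeta(6)-\frac{7}{64}\zeta(3)^2+\frac12\zeta^\star(\bar5,\bar1)+\frac12\zeta^\star(4,\bar2)+2\,\zeta^\star(\bar4,2)+4\,\zeta^\star(\bar5,1),$$ $$\sum_{n=1}^\infty \frac{H_nL_n(1)}{n^4}(-1)^{n-1} = -\frac32\zeta(2)\zeta(3)\ln2+\frac{155}{32}\zeta(5)\ln2+\frac{7}{64}\zeta(6)+\frac54\zeta(3)^2+\zeta^\star(\bar4,2)+\frac32\zeta^\star(\bar5,1).$$ -/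

import Mathlib

open Finset

/-- The alternating harmonic numbers `L_n(k) = ∑_{j=1}^n (-1)^(j-1) / j^k`
(the summation index is shifted by one, so that the sum runs over `0 ≤ j < n`). -/
noncomputable def altHarmonic (n k : ℕ) : ℝ :=
  ∑ j ∈ range n, (-1 : ℝ) ^ j / ((j : ℝ) + 1) ^ k

/-- The real number `ζ(k)` for an integer `k ≥ 2`. -/
noncomputable def zetaVal (k : ℕ) : ℝ := (riemannZeta (k : ℂ)).re

/-- The general term, at `m + 1`, of the double zeta-star value below:
`ε^(m+1) / (m+1)^p * ∑_{n=1}^{m+1} δ^n / n^q`. -/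
noncomputable def zetaStarTerm (ε : ℝ) (p : ℕ) (δ : ℝ) (q : ℕ) (m : ℕ) : ℝ :=
  ε ^ (m + 1) / ((m : ℝ) + 1) ^ p * ∑ n ∈ range (m + 1), δ ^ (n + 1) / ((n : ℝ) + 1) ^ q

/-- The (possibly alternating) double zeta-star value
`∑_{m ≥ n ≥ 1} ε^m δ^n / (m^p n^q)`, summed over `n` first.
The sign `ε = -1` (resp. `δ = -1`) corresponds to a bar over `p` (resp. over `q`),
the sign `1` to no bar. -/
noncomputable def zetaStar (ε : ℝ) (p : ℕ) (δ : ℝ) (q : ℕ) : ℝ :=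
  ∑' m : ℕ, zetaStarTerm ε p δ q m

/-- `zetaVal k` is the value of the Riemann zeta function at `k`, and the sum of its series. -/
theorem zetaVal_spec {k : ℕ} (hk : 2 ≤ k) :
    ((zetaVal k : ℝ) : ℂ) = riemannZeta (k : ℂ) ∧
      HasSum (fun n : ℕ => 1 / ((n : ℝ) + 1) ^ k) (zetaVal k) := by
  have hs : Summable (fun n : ℕ => 1 / (n : ℝ) ^ k) :=
    Real.summable_one_div_nat_pow.mpr (by omega)
  have h : riemannZeta (k : ℂ) = ((∑' n : ℕ, 1 / (n : ℝ) ^ k : ℝ) : ℂ) := by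
    rw [zeta_nat_eq_tsum_of_gt_one (by omega)]
    push_cast
    rfl
  have hv : zetaVal k = ∑' n : ℕ, 1 / (n : ℝ) ^ k := by
    rw [zetaVal, h, Complex.ofReal_re]
  refine ⟨by rw [hv, h], ?_⟩
  have h2 := (hasSum_nat_add_iff' (f := fun n : ℕ => 1 / (n : ℝ) ^ k) 1).mpr hs.hasSum
  rw [hv]
  have hk0 : k ≠ 0 := by omega
  simpa [hk0] using h2

/-- The series defining `zetaStar` converges absolutely (here for `p ≥ 3`). -/
theorem summable_zetaStarTerm {ε δ : ℝ} (hε : |ε| = 1) (hδ : |δ| = 1) {p : ℕ} (hp : 3 ≤ p)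
    (q : ℕ) : Summable (zetaStarTerm ε p δ q) := by
  have hs : Summable (fun m : ℕ => 1 / ((m : ℝ) + 1) ^ (p - 1)) := by
    have := (summable_nat_add_iff 1).mpr
      (Real.summable_one_div_nat_pow.mpr (show 1 < p - 1 by omega))
    simpa using this
  refine Summable.of_norm_bounded hs fun m => ?_
  have hm : (0 : ℝ) < (m : ℝ) + 1 := by positivity
  have h1 : |∑ n ∈ range (m + 1), δ ^ (n + 1) / ((n : ℝ) + 1) ^ q| ≤ (m : ℝ) + 1 := by
    calc _ ≤ ∑ n ∈ range (m + 1), |δ ^ (n + 1) / ((n : ℝ) + 1) ^ q| := abs_sum_le_sum_abs _ _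
      _ ≤ ∑ n ∈ range (m + 1), (1 : ℝ) := by
          refine sum_le_sum fun n _ => ?_
          have hn : (1 : ℝ) ≤ ((n : ℝ) + 1) ^ q :=
            one_le_pow₀ (by linarith [Nat.cast_nonneg (α := ℝ) n])
          rw [abs_div, abs_pow, hδ, one_pow, abs_of_pos (by linarith)]
          exact (div_le_one (by linarith)).mpr hn
      _ = (m : ℝ) + 1 := by simp
  rw [zetaStarTerm, Real.norm_eq_abs, abs_mul, abs_div, abs_pow, hε, one_pow,
    abs_of_pos (pow_pos hm p)]
  calc _ ≤ 1 / ((m : ℝ) + 1) ^ p * ((m : ℝ) + 1) := by gcongr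
    _ = 1 / ((m : ℝ) + 1) ^ (p - 1) := by
      obtain ⟨r, rfl⟩ : ∃ r, p = r + 1 := ⟨p - 1, by omega⟩
      simp only [Nat.add_sub_cancel]
      field_simp
      ring

/-! The proof is the residue method for Euler sums: integrate `K(s) / s^m`, where the kernel `K` is
a product of functions with poles at integers, whose local expansions there have harmonic sums as
coefficients. The contour integral is replaced by algebra. Each kernel is truncated to a rational
function, and the residues of a rational function that is `O(s^(-2))` add up to zero
(`sum_residue_eq_zero`), by partial fractions. Dominated convergence then lets the truncation grow
(`hasSum_residue_natPoints`, `hasSum_residue_intPoints`).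

For sign `1`, `twoSided`, `oneSided` and `oneSidedSq` truncate `π cot πs`, `ψ(-s) + γ` and `ψ'(-s)`.
For sign `-1`, the first becomes `π / sin πs` and the second an alternating analogue of digamma.

In `twoSided * oneSided * oneSided / s^4` the points `n` and `-n` contribute the same quadratic
term, so `hasSum_quadratic` expresses every quadratic sum by double sums of weights five and six.
Simpler kernels evaluate the sums of weight five, `ζ*(5,1)` and `ζ*(5,1̄)`; together with the
symmetry of `ζ*(3,3)` they also give `ζ*(4,2)`. The five remaining sums of weight six satisfy three
relations: two instances of `zetaStar_distribution`, and `zetaStar_four_two_sub`. Everything is thus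
expressed by `ζ*(4̄,2)` and `ζ*(5̄,1)`, and the five values become polynomial identities. -/

namespace EulerSum

/-! ### Residues of rational functions as coefficients of power series. -/

/-- The power series `u / (u + d)`, with the value `1` at `d = 0`. -/
noncomputable def polePart (d : ℝ) : PowerSeries ℝ :=
  PowerSeries.mk fun r => if r = 0 then (if d = 0 then 1 else 0) else -(-1) ^ r / d ^ r

lemma coeff_zero_polePart (d : ℝ) :
    PowerSeries.coeff 0 (polePart d) = if d = 0 then 1 else 0 := by
  simp [polePart]

lemma coeff_polePart {r : ℕ} (hr : r ≠ 0) (d : ℝ) :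
    PowerSeries.coeff r (polePart d) = -(-1) ^ r / d ^ r := by
  simp [polePart, hr]

lemma polePart_zero : polePart 0 = 1 := by
  ext r
  -- For `r ≠ 0` the coefficient at `d = 0` is a division by `0`, whose value `0` is the correct
  -- one.
  by_cases hr : r = 0 <;> simp [polePart, PowerSeries.coeff_one, hr]

/-- With `u = s - p` and `d = p - q` one has `u + d = s - q`, so `polePart (p - q)` is the expansion
of `(s - p) / (s - q)` at `p`. -/
lemma X_add_C_mul_polePart (d : ℝ) :
    (PowerSeries.X + PowerSeries.C d) * polePart d = PowerSeries.X := by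
  rcases eq_or_ne d 0 with rfl | hd
  · simp [polePart_zero]
  ext r
  rw [add_mul, map_add, PowerSeries.coeff_C_mul]
  rcases r with _ | _ | r
  · simp [polePart, hd]
  · rw [PowerSeries.coeff_succ_X_mul]
    simp [polePart, hd]
  · rw [PowerSeries.coeff_succ_X_mul, coeff_polePart (by omega), coeff_polePart (by omega),
      PowerSeries.coeff_X]
    simp only [Nat.add_eq_right, Nat.add_eq_zero_iff, one_ne_zero, and_false, if_false]
    field_simp
    ring

lemma X_dvd_polePart {d : ℝ} (hd : d ≠ 0) : PowerSeries.X ∣ polePart d := by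
  rw [PowerSeries.X_dvd_iff, ← PowerSeries.coeff_zero_eq_constantCoeff_apply,
    coeff_zero_polePart, if_neg hd]

/-- Partial fractions for two distinct poles. -/
lemma C_mul_polePart_mul_polePart (p q q' : ℝ) :
    PowerSeries.C (q - q') * (polePart (p - q) * polePart (p - q'))
      = PowerSeries.X * (polePart (p - q) - polePart (p - q')) := by
  have h := X_add_C_mul_polePart (p - q)
  have h' := X_add_C_mul_polePart (p - q')
  have hc : PowerSeries.C (q - q') = PowerSeries.C (p - q') - PowerSeries.C (p - q) := by
    rw [← map_sub]; congr 1; ring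
  rw [hc]
  linear_combination polePart (p - q) * h' - polePart (p - q') * h

/-- The residues of `∏_{q ∈ M} 1 / (s - q)` add up to zero if `M` has at least two elements,
and to one if `M` has one element. -/
lemma sum_residue_prod (P : Finset ℝ) (n : ℕ) (M : Multiset ℝ) (hM : M.card = n + 1)
    (hP : ∀ q ∈ M, q ∈ P) :
    ∑ p ∈ P, PowerSeries.coeff n (M.map fun q => polePart (p - q)).prod
      = if n = 0 then 1 else 0 := by
  induction n generalizing M with
  | zero =>
    obtain ⟨q, rfl⟩ := Multiset.card_eq_one.mp hM
    have hq : q ∈ P := hP q (by simp)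
    simp only [Multiset.map_singleton, Multiset.prod_singleton, coeff_zero_polePart, sub_eq_zero]
    simp [hq]
  | succ n ih =>
    obtain ⟨q, hq⟩ := Multiset.card_pos_iff_exists_mem.mp (show 0 < M.card by omega)
    obtain ⟨M', rfl⟩ := Multiset.exists_cons_of_mem hq
    -- If all poles coincide, the product is `1` at that pole and divisible by `X ^ (n + 2)`
    -- elsewhere, so the coefficient of index `n + 1` vanishes.
    by_cases hall : ∀ q' ∈ M', q' = q
    · have hrep : M' = Multiset.replicate (n + 1) q :=
        Multiset.eq_replicate.mpr ⟨by simpa using hM, hall⟩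
      subst hrep
      rw [if_neg (by omega)]
      refine sum_eq_zero fun p _ => ?_
      rw [← Multiset.replicate_succ, Multiset.map_replicate, Multiset.prod_replicate]
      rcases eq_or_ne (p - q) 0 with h0 | h0
      · simp [h0, polePart_zero, PowerSeries.coeff_one]
      · exact PowerSeries.X_pow_dvd_iff.mp (pow_dvd_pow_of_dvd (X_dvd_polePart h0) _) _ (by omega)
    -- With two distinct poles, partial fractions give a difference of two products with one factor
    -- less. Both have the same residue sum (`1` or `0`), so the difference vanishes.
    · push Not at hall
      obtain ⟨q', hq', hne⟩ := hall
      obtain ⟨R, rfl⟩ := Multiset.exists_cons_of_mem hq'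
      have h1 := ih (q ::ₘ R) (by simpa using hM) (fun x hx => hP x (by
        simp only [Multiset.mem_cons] at hx ⊢; tauto))
      have h2 := ih (q' ::ₘ R) (by simpa using hM) (fun x hx => hP x (by
        simp only [Multiset.mem_cons] at hx ⊢; tauto))
      rw [if_neg (by omega)]
      have hqq : q - q' ≠ 0 := sub_ne_zero.mpr hne.symm
      refine (mul_eq_zero.mp ?_).resolve_left hqq
      rw [mul_sum]
      calc _ = ∑ p ∈ P, (PowerSeries.coeff n ((q ::ₘ R).map fun q => polePart (p - q)).prod
            - PowerSeries.coeff n ((q' ::ₘ R).map fun q => polePart (p - q)).prod) := by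
            refine sum_congr rfl fun p _ => ?_
            rw [← PowerSeries.coeff_C_mul, ← map_sub, ← PowerSeries.coeff_succ_X_mul n]
            refine congrArg _ ?_
            simp only [Multiset.map_cons, Multiset.prod_cons]
            linear_combination (R.map fun q => polePart (p - q)).prod
              * C_mul_polePart_mul_polePart p q q'
        _ = 0 := by rw [sum_sub_distrib, h1, h2, sub_self]

/-- The expansions, at the variable point `p`, of the linear combinations of the functions
`∏_{q ∈ M} 1 / (s - q)` with `M ⊆ P` and `k ≤ #M ≤ n`, multiplied by `(s - p) ^ n`. -/
noncomputable def polarSpan (P : Finset ℝ) (n k : ℕ) : Submodule ℝ (ℝ → PowerSeries ℝ) :=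
  Submodule.span ℝ {φ | ∃ (j : ℕ) (M : Multiset ℝ), j + M.card = n ∧ k ≤ M.card ∧
    (∀ q ∈ M, q ∈ P) ∧
    φ = fun p => PowerSeries.X ^ j * (M.map fun q => polePart (p - q)).prod}

lemma mul_mem_polarSpan {P : Finset ℝ} {n k n' k' : ℕ} {φ ψ : ℝ → PowerSeries ℝ}
    (hφ : φ ∈ polarSpan P n k) (hψ : ψ ∈ polarSpan P n' k') :
    (fun p => φ p * ψ p) ∈ polarSpan P (n + n') (k + k') := by
  have h := Submodule.mul_mem_mul hφ hψ
  rw [polarSpan, polarSpan, Submodule.span_mul_span] at h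
  refine Submodule.span_mono ?_ h
  rintro _ ⟨_, ⟨j, M, h1, h2, h3, rfl⟩, _, ⟨j', M', h1', h2', h3', rfl⟩, rfl⟩
  refine ⟨j + j', M + M', by rw [Multiset.card_add]; omega, by rw [Multiset.card_add]; omega,
    ?_, ?_⟩
  · intro q hq
    rcases Multiset.mem_add.mp hq with hq | hq
    exacts [h3 q hq, h3' q hq]
  · funext p
    simp only [Pi.mul_apply, Multiset.map_add, Multiset.prod_add]
    ring

lemma polePart_pow_mem_polarSpan {P : Finset ℝ} {q : ℝ} (hq : q ∈ P) (m : ℕ) :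
    (fun p => polePart (p - q) ^ m) ∈ polarSpan P m m := by
  refine Submodule.subset_span ⟨0, Multiset.replicate m q, by simp, by simp, ?_, ?_⟩
  · intro x hx
    rwa [Multiset.eq_of_mem_replicate hx]
  · funext p
    simp

lemma X_pow_mem_polarSpan (P : Finset ℝ) (n : ℕ) :
    (fun _ => PowerSeries.X ^ n) ∈ polarSpan P n 0 :=
  Submodule.subset_span ⟨n, 0, by simp, by simp, by simp, by simp⟩

lemma polarSpan_anti {P : Finset ℝ} {n k k' : ℕ} (h : k' ≤ k) :
    polarSpan P n k ≤ polarSpan P n k' :=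
  Submodule.span_mono fun _ ⟨j, M, h1, h2, h3⟩ => ⟨j, M, h1, h.trans h2, h3⟩

/-- The residues of a rational function that decays at least quadratically add up to zero. -/
lemma sum_residue_eq_zero {P : Finset ℝ} {n k : ℕ} {φ : ℝ → PowerSeries ℝ} (hk : 2 ≤ k)
    (hφ : φ ∈ polarSpan P n k) : ∑ p ∈ P, PowerSeries.coeff (n - 1) (φ p) = 0 := by
  refine Submodule.span_induction (p := fun φ _ => ∑ p ∈ P, PowerSeries.coeff (n - 1) (φ p) = 0)
    ?_ (by simp) (fun x y _ _ hx hy => by simp [sum_add_distrib, hx, hy])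
    (fun c x _ hx => by simp [← mul_sum, hx]) hφ
  rintro _ ⟨j, M, h1, h2, h3, rfl⟩
  have h := sum_residue_prod P (M.card - 1) M (by omega) h3
  rw [if_neg (by omega)] at h
  rw [← h]
  refine sum_congr rfl fun p _ => ?_
  -- `X ^ j` only compensates for normalizing by `(s - p) ^ n` instead of `(s - p) ^ M.card`, so it
  -- shifts the index of the residue by `j`.
  rw [show n - 1 = M.card - 1 + j by omega, PowerSeries.coeff_X_pow_mul]

/-! ### Truncated kernels and their local expansions. -/

open Filter Topology

/-- The partial sums `∑_{i=1}^M ε^i / i^r`. -/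
noncomputable def powSum (ε : ℝ) (r M : ℕ) : ℝ :=
  ∑ i ∈ range M, ε ^ (i + 1) / ((i : ℝ) + 1) ^ r

lemma powSum_zero (ε : ℝ) (r : ℕ) : powSum ε r 0 = 0 := by simp [powSum]

lemma powSum_succ (ε : ℝ) (r M : ℕ) :
    powSum ε r (M + 1) = powSum ε r M + ε ^ (M + 1) / ((M : ℝ) + 1) ^ r := sum_range_succ _ _

lemma pow_mul_pow_of_sq {ε : ℝ} (hε : ε * ε = 1) (n : ℕ) : ε ^ n * ε ^ n = 1 := by
  rw [← mul_pow, hε, one_pow]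

lemma abs_pow_of_sq {ε : ℝ} (hε : ε * ε = 1) (n : ℕ) : |ε ^ n| = 1 := by
  rcases mul_self_eq_one_iff.mp hε with h | h <;> simp [h]

lemma sum_pow_div_add_pow {ε : ℝ} (hε : ε * ε = 1) (r m K : ℕ) :
    ∑ k ∈ range K, ε ^ k / ((m : ℝ) + 1 + k) ^ r
      = ε ^ (m + 1) * (powSum ε r (m + K) - powSum ε r m) := by
  rw [powSum, sum_range_add, ← powSum, add_sub_cancel_left, mul_sum]
  refine sum_congr rfl fun k _ => ?_
  have h : ε ^ k = ε ^ (m + 1) * ε ^ (m + k + 1) := by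
    rw [show m + k + 1 = (m + 1) + k by ring, pow_add ε (m + 1) k, ← mul_assoc,
      pow_mul_pow_of_sq hε, one_mul]
  rw [h, mul_div_assoc]
  push_cast
  ring

lemma sum_pow_div_sub_pow {ε : ℝ} (hε : ε * ε = 1) {r n N : ℕ} (hr : r ≠ 0) (hn : n ≤ N) :
    ∑ k ∈ range (N + 1), ε ^ k / ((n : ℝ) - k) ^ r
      = ε ^ n * (powSum ε r n + (-1) ^ r * powSum ε r (N - n)) := by
  obtain ⟨t, rfl⟩ := Nat.exists_eq_add_of_le hn
  rw [Nat.add_sub_cancel_left, add_assoc, sum_range_add, mul_add]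
  congr 1
  · rw [← sum_range_reflect, powSum, mul_sum]
    refine sum_congr rfl fun i hi => ?_
    have hi := mem_range.mp hi
    have h : ε ^ n * ε ^ (i + 1) = ε ^ (n - 1 - i) := by
      rw [show n = n - 1 - i + (i + 1) by omega, pow_add, mul_assoc, pow_mul_pow_of_sq hε, mul_one]
      congr 1
      omega
    rw [← mul_div_assoc, h]
    congr 2
    rw [Nat.sub_sub, Nat.cast_sub (by omega)]
    push_cast
    ring
  · rw [sum_range_succ', powSum, mul_sum, mul_sum]
    -- The term `k = n` is a division by `0` and counts as `0`; that pole is recorded in the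
    -- coefficient of index `0`.
    simp only [add_zero, sub_self, zero_pow hr, div_zero]
    refine sum_congr rfl fun i _ => ?_
    have h : ((n : ℝ) - ((n + (i + 1) : ℕ) : ℝ)) = -1 * ((i : ℝ) + 1) := by push_cast; ring
    rw [h, mul_pow, pow_add ε n]
    rcases neg_one_pow_eq_or ℝ r with h | h <;> simp [h] <;> ring

/-- The expansion at `p` of `c + ∑_{k=0}^N ε^k / (s - k)`, multiplied by `s - p`. -/
noncomputable def oneSided (ε c : ℝ) (N : ℕ) (p : ℝ) : PowerSeries ℝ :=
  ∑ k ∈ range (N + 1), PowerSeries.C (ε ^ k) * polePart (p - k) + PowerSeries.C c * PowerSeries.X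

/-- The expansion at `p` of `∑_{k=0}^N 1 / (s - k)^2`, multiplied by `(s - p)^2`. -/
noncomputable def oneSidedSq (N : ℕ) (p : ℝ) : PowerSeries ℝ :=
  ∑ k ∈ range (N + 1), polePart (p - k) ^ 2

/-- The expansion at `p` of `∑_{k=-N}^N ε^k / (s - k)`, multiplied by `s - p`. -/
noncomputable def twoSided (ε : ℝ) (N : ℕ) (p : ℝ) : PowerSeries ℝ :=
  ∑ k ∈ range (N + 1), PowerSeries.C (ε ^ k) * polePart (p - k)
    + ∑ k ∈ range N, PowerSeries.C (ε ^ (k + 1)) * polePart (p + (k + 1))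

lemma coeff_zero_oneSided (ε c : ℝ) {n N : ℕ} (hn : n ≤ N) :
    PowerSeries.coeff 0 (oneSided ε c N n) = ε ^ n := by
  rw [oneSided, map_add, map_sum, sum_eq_single n]
  · simp [polePart_zero]
  · intro k _ hk
    rw [PowerSeries.coeff_C_mul, coeff_zero_polePart, if_neg, mul_zero]
    exact sub_ne_zero.mpr (by exact_mod_cast hk.symm)
  · intro h
    exact absurd (mem_range.mpr (by omega)) h

lemma coeff_oneSided {ε : ℝ} (hε : ε * ε = 1) (c : ℝ) {r n N : ℕ} (hr : r ≠ 0) (hn : n ≤ N) :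
    PowerSeries.coeff r (oneSided ε c N n)
      = -(-1) ^ r * (ε ^ n * (powSum ε r n + (-1) ^ r * powSum ε r (N - n)))
        + if r = 1 then c else 0 := by
  rw [oneSided, map_add, map_sum, ← sum_pow_div_sub_pow hε hr hn, mul_sum]
  congr 1
  · refine sum_congr rfl fun k _ => ?_
    rw [PowerSeries.coeff_C_mul, coeff_polePart hr]
    ring
  · rw [PowerSeries.coeff_C_mul, PowerSeries.coeff_X]
    simp

lemma coeff_zero_oneSided_neg (ε c : ℝ) (n N : ℕ) :
    PowerSeries.coeff 0 (oneSided ε c N (-((n : ℝ) + 1))) = 0 := by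
  rw [oneSided, map_add, map_sum, sum_eq_zero]
  · simp
  · intro k _
    rw [PowerSeries.coeff_C_mul, coeff_zero_polePart, if_neg, mul_zero]
    have : (0 : ℝ) < n + 1 + k := by positivity
    intro h
    linarith

lemma coeff_oneSided_neg {ε : ℝ} (hε : ε * ε = 1) (c : ℝ) {r : ℕ} (n N : ℕ) (hr : r ≠ 0) :
    PowerSeries.coeff r (oneSided ε c N (-((n : ℝ) + 1)))
      = -(ε ^ (n + 1) * (powSum ε r (n + (N + 1)) - powSum ε r n)) + if r = 1 then c else 0 := by
  rw [oneSided, map_add, map_sum, ← sum_pow_div_add_pow hε, ← sum_neg_distrib]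
  congr 1
  · refine sum_congr rfl fun k _ => ?_
    rw [PowerSeries.coeff_C_mul, coeff_polePart hr,
      show -((n : ℝ) + 1) - k = -1 * ((n : ℝ) + 1 + k) by ring, mul_pow]
    rcases neg_one_pow_eq_or ℝ r with h | h <;> simp [h] <;> ring
  · rw [PowerSeries.coeff_C_mul, PowerSeries.coeff_X]
    simp

lemma coeff_polePart_neg (r : ℕ) (d : ℝ) :
    PowerSeries.coeff r (polePart (-d)) = (-1) ^ r * PowerSeries.coeff r (polePart d) := by
  rcases eq_or_ne r 0 with rfl | hr
  · simp [coeff_zero_polePart]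
  rw [coeff_polePart hr, coeff_polePart hr, neg_pow d]
  rcases neg_one_pow_eq_or ℝ r with h | h <;> simp [h]

/-- The symmetric sum over `-N ≤ k ≤ N` is an odd function of `s`, so its product with `s - p` is
unchanged under `(s, p) ↦ (-s, -p)`, which sends `u` to `-u`. -/
lemma coeff_twoSided_neg (ε : ℝ) (r N : ℕ) (p : ℝ) :
    PowerSeries.coeff r (twoSided ε N (-p)) = (-1) ^ r * PowerSeries.coeff r (twoSided ε N p) := by
  simp only [twoSided]
  rw [sum_range_succ', sum_range_succ']
  simp only [map_add, map_sum, PowerSeries.coeff_C_mul, mul_add, mul_sum]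
  have h1 : ∀ k : ℕ, PowerSeries.coeff r (polePart (-p - ((k + 1 : ℕ) : ℝ)))
      = (-1) ^ r * PowerSeries.coeff r (polePart (p + (k + 1))) := fun k => by
    rw [← coeff_polePart_neg]; push_cast; congr 2; ring
  have h2 : ∀ k : ℕ, PowerSeries.coeff r (polePart (-p + (k + 1)))
      = (-1) ^ r * PowerSeries.coeff r (polePart (p - ((k + 1 : ℕ) : ℝ))) := fun k => by
    rw [← coeff_polePart_neg]; push_cast; congr 2; ring
  have h3 : PowerSeries.coeff r (polePart (-p - ((0 : ℕ) : ℝ)))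
      = (-1) ^ r * PowerSeries.coeff r (polePart (p - ((0 : ℕ) : ℝ))) := by
    rw [← coeff_polePart_neg]; push_cast; congr 2; ring
  simp only [h1, h2, h3, mul_left_comm]
  ring

lemma coeff_zero_twoSided (ε : ℝ) {n N : ℕ} (hn : n ≤ N) :
    PowerSeries.coeff 0 (twoSided ε N n) = ε ^ n := by
  have h := coeff_zero_oneSided ε 0 hn
  rw [oneSided, map_zero, zero_mul, add_zero] at h
  rw [twoSided, map_add, h, map_sum, sum_eq_zero, add_zero]
  intro k _
  rw [PowerSeries.coeff_C_mul, coeff_zero_polePart, if_neg (by positivity), mul_zero]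

lemma coeff_twoSided {ε : ℝ} (hε : ε * ε = 1) {r n N : ℕ} (hr : r ≠ 0) (hn : n ≤ N) :
    PowerSeries.coeff r (twoSided ε N n)
      = -(-1) ^ r * (ε ^ n * (powSum ε r (n + N) + (-1) ^ r * powSum ε r (N - n))) := by
  have h := coeff_oneSided hε 0 hr hn
  rw [oneSided, map_zero, zero_mul, add_zero, ite_self, add_zero] at h
  rw [twoSided, map_add, h, map_sum]
  have h2 : ∑ k ∈ range N, PowerSeries.coeff r
      (PowerSeries.C (ε ^ (k + 1)) * polePart ((n : ℝ) + (k + 1)))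
      = -(-1) ^ r * (ε ^ n * (powSum ε r (n + N) - powSum ε r n)) := by
    have h3 := sum_pow_div_add_pow hε r n N
    have h4 : ε ^ n * (powSum ε r (n + N) - powSum ε r n)
        = ε * ∑ k ∈ range N, ε ^ k / ((n : ℝ) + 1 + k) ^ r := by
      rw [h3, pow_succ]
      linear_combination (-(ε ^ n * (powSum ε r (n + N) - powSum ε r n))) * hε
    rw [h4, mul_sum, mul_sum]
    refine sum_congr rfl fun k _ => ?_
    rw [PowerSeries.coeff_C_mul, coeff_polePart hr, pow_succ,
      show (n : ℝ) + (k + 1) = n + 1 + k by ring]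
    ring
  rw [h2]
  ring

lemma X_add_C_ne_zero (d : ℝ) : (PowerSeries.X + PowerSeries.C d : PowerSeries ℝ) ≠ 0 := by
  intro h
  have := congrArg (PowerSeries.coeff 1) h
  simp at this

/-- The factor `r - 1` kills the coefficient of index `1`. Hence the divergent harmonic sum never
enters `oneSidedSq`, and no regularizing constant is needed there. -/
lemma polePart_sq (d : ℝ) : polePart d ^ 2 = PowerSeries.mk fun r =>
    if r = 0 then (if d = 0 then 1 else 0) else ((r : ℝ) - 1) * ((-1) ^ r / d ^ r) := by
  rcases eq_or_ne d 0 with rfl | hd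
  · rw [polePart_zero, one_pow]
    ext r
    by_cases hr : r = 0 <;> simp [PowerSeries.coeff_one, hr]
  refine mul_left_cancel₀ (X_add_C_ne_zero d) ?_
  rw [sq, ← mul_assoc, X_add_C_mul_polePart]
  ext r
  rw [add_mul, map_add, PowerSeries.coeff_C_mul]
  rcases r with _ | _ | r
  · simp [polePart, hd]
  · rw [PowerSeries.coeff_succ_X_mul, PowerSeries.coeff_succ_X_mul]
    simp [polePart, hd]
  · rw [PowerSeries.coeff_succ_X_mul, PowerSeries.coeff_succ_X_mul, coeff_polePart (by omega),
      PowerSeries.coeff_mk, PowerSeries.coeff_mk, if_neg (by omega), if_neg (by omega)]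
    push_cast
    field_simp
    ring

lemma coeff_zero_oneSidedSq {n N : ℕ} (hn : n ≤ N) :
    PowerSeries.coeff 0 (oneSidedSq N n) = 1 := by
  rw [oneSidedSq, map_sum, sum_eq_single n]
  · simp [polePart_sq]
  · intro k _ hk
    rw [polePart_sq, PowerSeries.coeff_mk, if_pos rfl, if_neg]
    exact sub_ne_zero.mpr (by exact_mod_cast hk.symm)
  · intro h
    exact absurd (mem_range.mpr (by omega)) h

lemma coeff_oneSidedSq {r n N : ℕ} (hr : r ≠ 0) (hn : n ≤ N) :
    PowerSeries.coeff r (oneSidedSq N n)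
      = ((r : ℝ) - 1) * ((-1) ^ r * (powSum 1 r n + (-1) ^ r * powSum 1 r (N - n))) := by
  have h := sum_pow_div_sub_pow (ε := 1) (by norm_num) hr hn
  rw [one_pow, one_mul] at h
  rw [oneSidedSq, map_sum, ← h, mul_sum, mul_sum]
  refine sum_congr rfl fun k _ => ?_
  rw [polePart_sq, PowerSeries.coeff_mk, if_neg hr, one_pow]
  ring

/-! ### Pole sets, and membership of the kernels in `polarSpan`. -/

/-- The nonnegative integers up to `N`, as real numbers. -/
noncomputable def natPoints (N : ℕ) : Finset ℝ := (range (N + 1)).image fun k : ℕ => (k : ℝ)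

/-- The integers of absolute value at most `N`, as real numbers. -/
noncomputable def intPoints (N : ℕ) : Finset ℝ :=
  natPoints N ∪ (range N).image fun k : ℕ => -((k : ℝ) + 1)

lemma natCast_mem_natPoints {k N : ℕ} (h : k ≤ N) : (k : ℝ) ∈ natPoints N :=
  mem_image_of_mem _ (mem_range.mpr (by omega))

lemma natCast_mem_intPoints {k N : ℕ} (h : k ≤ N) : (k : ℝ) ∈ intPoints N :=
  mem_union_left _ (natCast_mem_natPoints h)

lemma neg_mem_intPoints {k N : ℕ} (h : k < N) : -((k : ℝ) + 1) ∈ intPoints N :=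
  mem_union_right _ (mem_image_of_mem (fun k : ℕ => -((k : ℝ) + 1)) (mem_range.mpr h))

lemma sum_natPoints (N : ℕ) (F : ℝ → ℝ) :
    ∑ p ∈ natPoints N, F p = F 0 + ∑ n ∈ range N, F ((n : ℝ) + 1) := by
  rw [natPoints, sum_image (fun _ _ _ _ h => Nat.cast_injective h), sum_range_succ', add_comm]
  simp

lemma sum_intPoints (N : ℕ) (F : ℝ → ℝ) :
    ∑ p ∈ intPoints N, F p
      = F 0 + ∑ n ∈ range N, (F ((n : ℝ) + 1) + F (-((n : ℝ) + 1))) := by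
  have hd : Disjoint (natPoints N) ((range N).image fun k : ℕ => -((k : ℝ) + 1)) := by
    rw [disjoint_left]
    intro x hx hx'
    obtain ⟨a, _, rfl⟩ := mem_image.mp hx
    obtain ⟨b, _, hb⟩ := mem_image.mp hx'
    have : (0 : ℝ) < a + b + 1 := by positivity
    linarith
  rw [intPoints, sum_union hd, sum_natPoints, sum_image, sum_add_distrib, add_assoc]
  intro a _ b _ h
  have : (a : ℝ) = b := by simpa using h
  exact_mod_cast this

lemma const_mul_mem_polarSpan {P : Finset ℝ} {n k : ℕ} {φ : ℝ → PowerSeries ℝ}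
    (h : φ ∈ polarSpan P n k) (a : ℝ) : (fun p => PowerSeries.C a * φ p) ∈ polarSpan P n k := by
  have := (polarSpan P n k).smul_mem a h
  refine Set.mem_of_eq_of_mem (funext fun p => ?_) this
  rw [Pi.smul_apply, PowerSeries.smul_eq_C_mul]

lemma sum_mem_polarSpan {ι : Type*} {P : Finset ℝ} {n k : ℕ} (s : Finset ι)
    {φ : ι → ℝ → PowerSeries ℝ} (h : ∀ i ∈ s, φ i ∈ polarSpan P n k) :
    (fun p => ∑ i ∈ s, φ i p) ∈ polarSpan P n k := by
  have := Submodule.sum_mem (polarSpan P n k) h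
  refine Set.mem_of_eq_of_mem (funext fun p => ?_) this
  rw [Finset.sum_apply]

lemma polePart_mem_polarSpan {P : Finset ℝ} {q : ℝ} (hq : q ∈ P) :
    (fun p => polePart (p - q)) ∈ polarSpan P 1 0 :=
  polarSpan_anti (Nat.zero_le 1) (by simpa using polePart_pow_mem_polarSpan hq 1)

lemma oneSided_mem_polarSpan {P : Finset ℝ} {N : ℕ} (hP : ∀ k ≤ N, (k : ℝ) ∈ P) (ε c : ℝ) :
    oneSided ε c N ∈ polarSpan P 1 0 := by
  refine Submodule.add_mem _ (sum_mem_polarSpan _ fun k hk => ?_) ?_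
  · exact const_mul_mem_polarSpan (polePart_mem_polarSpan (hP k (by simp at hk; omega))) _
  · simpa using const_mul_mem_polarSpan (X_pow_mem_polarSpan P 1) c

lemma oneSidedSq_mem_polarSpan {P : Finset ℝ} {N : ℕ} (hP : ∀ k ≤ N, (k : ℝ) ∈ P) :
    oneSidedSq N ∈ polarSpan P 2 0 :=
  sum_mem_polarSpan _ fun k hk => polarSpan_anti (Nat.zero_le 2)
    (polePart_pow_mem_polarSpan (hP k (by simp at hk; omega)) 2)

lemma twoSided_mem_polarSpan (ε : ℝ) (N : ℕ) : twoSided ε N ∈ polarSpan (intPoints N) 1 0 := by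
  refine Submodule.add_mem _ (sum_mem_polarSpan _ fun k hk => ?_)
    (sum_mem_polarSpan _ fun k hk => ?_)
  · exact const_mul_mem_polarSpan
      (polePart_mem_polarSpan (natCast_mem_intPoints (by simp at hk; omega))) _
  · have := polePart_mem_polarSpan (neg_mem_intPoints (mem_range.mp hk))
    simp only [sub_neg_eq_add] at this
    exact const_mul_mem_polarSpan this _

/-! ### Passage to the limit in the sum of residues. -/

/-- Coefficientwise convergence of power series. -/
def CoeffTendsto (f : ℕ → PowerSeries ℝ) (g : PowerSeries ℝ) : Prop :=
  ∀ r, Tendsto (fun N => PowerSeries.coeff r (f N)) atTop (𝓝 (PowerSeries.coeff r g))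

lemma CoeffTendsto.mul {f f' : ℕ → PowerSeries ℝ} {g g' : PowerSeries ℝ}
    (h : CoeffTendsto f g) (h' : CoeffTendsto f' g') :
    CoeffTendsto (fun N => f N * f' N) (g * g') := fun r => by
  simp only [PowerSeries.coeff_mul]
  exact tendsto_finsetSum _ fun x _ => (h x.1).mul (h' x.2)

lemma CoeffTendsto.const (g : PowerSeries ℝ) : CoeffTendsto (fun _ => g) g :=
  fun _ => tendsto_const_nhds

/-- The coefficients of index `r` of `f N n` are bounded by a multiple of `h n ^ r`
for `n < N`. -/
def CoeffBounded (h : ℕ → ℝ) (f : ℕ → ℕ → PowerSeries ℝ) : Prop :=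
  ∀ r, ∃ C, ∀ N n, n < N → |PowerSeries.coeff r (f N n)| ≤ C * h n ^ r

lemma CoeffBounded.mul {h : ℕ → ℝ} {f f' : ℕ → ℕ → PowerSeries ℝ}
    (hf : CoeffBounded h f) (hf' : CoeffBounded h f') :
    CoeffBounded h (fun N n => f N n * f' N n) := by
  intro r
  choose C hC using hf
  choose C' hC' using hf'
  refine ⟨∑ x ∈ antidiagonal r, C x.1 * C' x.2, fun N n hn => ?_⟩
  rw [PowerSeries.coeff_mul, sum_mul]
  refine (abs_sum_le_sum_abs _ _).trans (sum_le_sum fun x hx => ?_)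
  rw [abs_mul, ← mem_antidiagonal.mp hx, pow_add]
  have h1 := hC x.1 N n hn
  have h2 := hC' x.2 N n hn
  calc _ ≤ (C x.1 * h n ^ x.1) * (C' x.2 * h n ^ x.2) :=
        mul_le_mul h1 h2 (abs_nonneg _) ((abs_nonneg _).trans h1)
    _ = _ := by ring

/-- The power series `1 / (u + d)` for `d ≠ 0`. -/
noncomputable def invSeries (d : ℝ) : PowerSeries ℝ :=
  PowerSeries.mk fun r => (-1) ^ r / d ^ (r + 1)

lemma polePart_eq_X_mul_invSeries {d : ℝ} (hd : d ≠ 0) :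
    polePart d = PowerSeries.X * invSeries d := by
  ext r
  rcases r with _ | r
  · simp [polePart, hd]
  · rw [PowerSeries.coeff_succ_X_mul, coeff_polePart (by omega), invSeries, PowerSeries.coeff_mk,
      pow_succ (-1 : ℝ)]
    ring

/-- Away from `0` the factor `1 / s ^ m` is regular, so the residue involves only the coefficients
of the kernel up to its own pole order. -/
lemma coeff_mul_polePart_pow {d : ℝ} (hd : d ≠ 0) (f : PowerSeries ℝ) (J m : ℕ) :
    PowerSeries.coeff (J + m) (f * polePart d ^ m)
      = PowerSeries.coeff J (f * invSeries d ^ m) := by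
  rw [polePart_eq_X_mul_invSeries hd, mul_pow, mul_left_comm, PowerSeries.coeff_X_pow_mul]

/-- Homogeneity: `1 / (u + d) = d⁻¹ * (1 / (u / d + 1))`. -/
lemma coeff_invSeries_pow (d : ℝ) (j m : ℕ) :
    PowerSeries.coeff j (invSeries d ^ m)
      = PowerSeries.coeff j (invSeries 1 ^ m) / d ^ (m + j) := by
  have h : invSeries d = PowerSeries.C (d⁻¹) * PowerSeries.rescale d⁻¹ (invSeries 1) := by
    ext r
    simp only [invSeries, PowerSeries.coeff_mk, PowerSeries.coeff_C_mul,
      PowerSeries.coeff_rescale, one_pow, inv_pow, pow_succ, div_eq_mul_inv, mul_inv]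
    ring
  rw [h, mul_pow, ← map_pow, ← map_pow, PowerSeries.coeff_C_mul, PowerSeries.coeff_rescale]
  rw [pow_add, inv_pow, inv_pow]
  ring_nf

/-- In the Cauchy product, the bound `h n ^ i` with `i ≤ J` is at most `h n ^ J`, and the additional
powers of `1 / |d|` are at most `1`. -/
lemma abs_coeff_mul_invSeries_pow_le {h : ℕ → ℝ} (h0 : ∀ n, 1 ≤ h n)
    {f : ℕ → ℕ → PowerSeries ℝ} (hf : CoeffBounded h f) (J m : ℕ) :
    ∃ C, ∀ N n : ℕ, n < N → ∀ d : ℝ, |d| = (n : ℝ) + 1 →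
      |PowerSeries.coeff J (f N n * invSeries d ^ m)| ≤ C * (h n ^ J / ((n : ℝ) + 1) ^ m) := by
  choose C hC using hf
  refine ⟨∑ x ∈ antidiagonal J, C x.1 * |PowerSeries.coeff x.2 (invSeries 1 ^ m)|,
    fun N n hn d hd => ?_⟩
  rw [PowerSeries.coeff_mul, sum_mul]
  refine (abs_sum_le_sum_abs _ _).trans (sum_le_sum fun x hx => ?_)
  have h1 := hC x.1 N n hn
  have hh : h n ^ x.1 ≤ h n ^ J :=
    pow_le_pow_right₀ (h0 n) (by have := mem_antidiagonal.mp hx; omega)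
  have hh0 : 0 < h n ^ x.1 := pow_pos (by linarith [h0 n]) _
  have hC0 : 0 ≤ C x.1 := by
    have := (abs_nonneg _).trans h1
    exact nonneg_of_mul_nonneg_left this hh0
  have h2 : |PowerSeries.coeff x.1 (f N n)| ≤ C x.1 * h n ^ J := h1.trans (by gcongr)
  have h3 : 0 ≤ C x.1 * h n ^ J := (abs_nonneg _).trans h2
  have hn1 : (1 : ℝ) ≤ (n : ℝ) + 1 := by linarith [Nat.cast_nonneg (α := ℝ) n]
  rw [abs_mul, coeff_invSeries_pow, abs_div, abs_pow, hd, pow_add]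
  calc _ ≤ (C x.1 * h n ^ J) * (|PowerSeries.coeff x.2 (invSeries 1 ^ m)| /
          (((n : ℝ) + 1) ^ m * 1)) := by
        have := one_le_pow₀ hn1 (n := x.2)
        gcongr
    _ = _ := by ring

/-- Tannery's theorem: `Z N` is the residue at `0`, `F N n` those at the other poles, and `b`
dominates uniformly in the truncation `N`. -/
lemma hasSum_of_sum_eq_zero {F : ℕ → ℕ → ℝ} {G b : ℕ → ℝ} {Z : ℕ → ℝ} {z : ℝ}
    (hb : Summable b) (hF : ∀ N n, n < N → |F N n| ≤ b n)
    (hG : ∀ n, Tendsto (fun N => F N n) atTop (𝓝 (G n)))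
    (hZ : Tendsto Z atTop (𝓝 z)) (h : ∀ N, Z N + ∑ n ∈ range N, F N n = 0) :
    HasSum G (-z) := by
  have hb0 : ∀ n, 0 ≤ b n := fun n => (abs_nonneg _).trans (hF (n + 1) n (by omega))
  have hGb : ∀ n, ‖G n‖ ≤ b n := fun n =>
    le_of_tendsto (hG n).norm ((eventually_gt_atTop n).mono fun N hN => hF N n hN)
  have hsum : Summable G := Summable.of_norm_bounded hb hGb
  have hT : Tendsto (fun N => ∑' n, if n < N then F N n else 0) atTop (𝓝 (∑' n, G n)) := by
    refine tendsto_tsum_of_dominated_convergence hb (fun n => ?_) (Eventually.of_forall ?_)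
    · refine (hG n).congr' ((eventually_gt_atTop n).mono fun N hN => ?_)
      simp only [if_pos hN]
    · intro N n
      split_ifs with hn
      · exact hF N n hn
      · simpa using hb0 n
  have hE : (fun N => ∑' n, if n < N then F N n else 0) = fun N => -Z N := by
    funext N
    rw [tsum_eq_sum (s := range N) (fun n hn => if_neg (by simpa using hn)),
      ← eq_neg_of_add_eq_zero_right (h N)]
    exact sum_congr rfl fun n hn => if_pos (mem_range.mp hn)
  rw [hE] at hT
  rw [← tendsto_nhds_unique hT hZ.neg]
  exact hsum.hasSum

/-- Summation of the residues of a function with poles at the nonnegative integers. -/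
lemma hasSum_residue_natPoints {h : ℕ → ℝ} (h0 : ∀ n, 1 ≤ h n) {J m k : ℕ} (hkm : 2 ≤ k + m)
    {φ : ℕ → ℝ → PowerSeries ℝ} {g : ℕ → PowerSeries ℝ} {g₀ : PowerSeries ℝ}
    (hφ : ∀ N, φ N ∈ polarSpan (natPoints N) (J + 1) k)
    (hg : ∀ n : ℕ, CoeffTendsto (fun N => φ N ((n : ℝ) + 1)) (g n))
    (hb : CoeffBounded h fun N n => φ N ((n : ℝ) + 1))
    (hg₀ : CoeffTendsto (fun N => φ N 0) g₀)
    (hs : Summable fun n : ℕ => h n ^ J / ((n : ℝ) + 1) ^ m) :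
    HasSum (fun n : ℕ => PowerSeries.coeff J (g n * invSeries ((n : ℝ) + 1) ^ m))
      (-PowerSeries.coeff (J + m) g₀) := by
  obtain ⟨C, hC⟩ := abs_coeff_mul_invSeries_pow_le h0 hb J m
  refine hasSum_of_sum_eq_zero
    (F := fun N n => PowerSeries.coeff J (φ N ((n : ℝ) + 1) * invSeries ((n : ℝ) + 1) ^ m))
    (hs.mul_left C)
    (fun N n hn => hC N n hn _ (abs_of_pos (by positivity)))
    (fun n => (hg n).mul (CoeffTendsto.const _) J) (hg₀ (J + m)) fun N => ?_
  -- The factor `1 / s ^ m` enters as `polePart (p - 0) ^ m`. It equals `1` at `p = 0`, so the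
  -- residue there is the coefficient of index `J + m`.
  have h1 := sum_residue_eq_zero hkm (mul_mem_polarSpan (hφ N) (polePart_pow_mem_polarSpan
    (by simpa using natCast_mem_natPoints (Nat.zero_le N) : (0 : ℝ) ∈ natPoints N) m))
  rw [sum_natPoints] at h1
  simp only [sub_zero, polePart_zero, one_pow, mul_one] at h1
  rw [show J + 1 + m - 1 = J + m by omega] at h1
  refine Eq.trans ?_ h1
  refine congrArg _ (sum_congr rfl fun n _ => ?_)
  rw [coeff_mul_polePart_pow (by positivity)]

/-- Summation of the residues of a function with poles at the integers. -/
lemma hasSum_residue_intPoints {h : ℕ → ℝ} (h0 : ∀ n, 1 ≤ h n) {J m k : ℕ} (hkm : 2 ≤ k + m)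
    {φ : ℕ → ℝ → PowerSeries ℝ} {g g' : ℕ → PowerSeries ℝ} {g₀ : PowerSeries ℝ}
    (hφ : ∀ N, φ N ∈ polarSpan (intPoints N) (J + 1) k)
    (hg : ∀ n : ℕ, CoeffTendsto (fun N => φ N ((n : ℝ) + 1)) (g n))
    (hb : CoeffBounded h fun N n => φ N ((n : ℝ) + 1))
    (hg' : ∀ n : ℕ, CoeffTendsto (fun N => φ N (-((n : ℝ) + 1))) (g' n))
    (hb' : CoeffBounded h fun N n => φ N (-((n : ℝ) + 1)))
    (hg₀ : CoeffTendsto (fun N => φ N 0) g₀)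
    (hs : Summable fun n : ℕ => h n ^ J / ((n : ℝ) + 1) ^ m) :
    HasSum (fun n : ℕ => PowerSeries.coeff J (g n * invSeries ((n : ℝ) + 1) ^ m)
        + PowerSeries.coeff J (g' n * invSeries (-((n : ℝ) + 1)) ^ m))
      (-PowerSeries.coeff (J + m) g₀) := by
  obtain ⟨C, hC⟩ := abs_coeff_mul_invSeries_pow_le h0 hb J m
  obtain ⟨C', hC'⟩ := abs_coeff_mul_invSeries_pow_le h0 hb' J m
  refine hasSum_of_sum_eq_zero
    (F := fun N n => PowerSeries.coeff J (φ N ((n : ℝ) + 1) * invSeries ((n : ℝ) + 1) ^ m)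
      + PowerSeries.coeff J (φ N (-((n : ℝ) + 1)) * invSeries (-((n : ℝ) + 1)) ^ m))
    ((hs.mul_left C).add (hs.mul_left C'))
    (fun N n hn => (abs_add_le _ _).trans (add_le_add
      (hC N n hn _ (abs_of_pos (by positivity)))
      (hC' N n hn _ (by rw [abs_neg]; exact abs_of_pos (by positivity)))))
    (fun n => ((hg n).mul (CoeffTendsto.const _) J).add ((hg' n).mul (CoeffTendsto.const _) J))
    (hg₀ (J + m)) fun N => ?_
  have h1 := sum_residue_eq_zero hkm (mul_mem_polarSpan (hφ N) (polePart_pow_mem_polarSpan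
    (by simpa using natCast_mem_intPoints (Nat.zero_le N) : (0 : ℝ) ∈ intPoints N) m))
  rw [sum_intPoints] at h1
  simp only [sub_zero, polePart_zero, one_pow, mul_one] at h1
  rw [show J + 1 + m - 1 = J + m by omega] at h1
  refine Eq.trans ?_ h1
  refine congrArg _ (sum_congr rfl fun n _ => ?_)
  rw [coeff_mul_polePart_pow (by positivity),
    coeff_mul_polePart_pow (neg_ne_zero.mpr (by positivity))]

/-! ### Regularized limits of the partial sums and of the kernels. -/

lemma abs_powSum_add_sub_le {ε : ℝ} (hε : ε * ε = 1) (r M n : ℕ) :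
    |powSum ε r (M + n) - powSum ε r M| ≤ n := by
  rw [powSum, sum_range_add, ← powSum, add_sub_cancel_left]
  refine (abs_sum_le_sum_abs _ _).trans ?_
  calc _ ≤ ∑ _i ∈ range n, (1 : ℝ) := sum_le_sum fun i _ => by
        have : (1 : ℝ) ≤ ((M + i : ℕ) : ℝ) + 1 := by linarith [Nat.cast_nonneg (α := ℝ) (M + i)]
        have := one_le_pow₀ this (n := r)
        rw [abs_div, abs_pow_of_sq hε, abs_of_pos (by linarith)]
        exact (div_le_one (by linarith)).mpr this
    _ = n := by simp

lemma tendsto_powSum_add_sub {ε : ℝ} (hε : ε * ε = 1) {r : ℕ} (hr : r ≠ 0) (n : ℕ) :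
    Tendsto (fun M => powSum ε r (M + n) - powSum ε r M) atTop (𝓝 0) := by
  induction n with
  | zero => simp
  | succ n ih =>
    have h1 : Tendsto (fun M : ℕ => ε ^ (M + n + 1) / (((M + n : ℕ) : ℝ) + 1) ^ r) atTop (𝓝 0) := by
      have h2 : Tendsto (fun M : ℕ => 1 / (M : ℝ)) atTop (𝓝 0) :=
        tendsto_one_div_atTop_nhds_zero_nat
      have h3 := (h2.pow r).comp (tendsto_add_atTop_nat (n + 1))
      rw [zero_pow hr] at h3
      refine squeeze_zero_norm (fun M => le_of_eq ?_) h3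
      rw [Real.norm_eq_abs, abs_div, abs_pow_of_sq hε, Function.comp_apply, div_pow, one_pow,
        abs_of_pos (by positivity)]
      push_cast
      ring
    have := ih.add h1
    rw [add_zero] at this
    refine this.congr fun M => ?_
    rw [← add_assoc, powSum_succ]
    ring

/-- The numbers `z r` are the limits of `powSum ε r`, where for `r = 1` the sequence `c` is
subtracted from the partial sums. -/
structure RegLimit (ε : ℝ) (c z : ℕ → ℝ) : Prop where
  sq : ε * ε = 1
  -- This forces `c = 0` when `ε = -1`, and lets `c N` be absorbed into the common factor `ε ^ n` of
  -- the coefficient of index `1`.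
  inv : ∀ N, ε * c N = c N
  lim_one : Tendsto (fun N => powSum ε 1 N - c N) atTop (𝓝 (z 1))
  lim : ∀ r, 2 ≤ r → Tendsto (powSum ε r) atTop (𝓝 (z r))

lemma exists_abs_le_of_tendsto {u : ℕ → ℝ} {a : ℝ} (h : Tendsto u atTop (𝓝 a)) :
    ∃ B, 0 ≤ B ∧ ∀ N, |u N| ≤ B := by
  obtain ⟨B, hB⟩ := (Metric.isBounded_range_of_tendsto u h).exists_norm_le
  exact ⟨B, (norm_nonneg _).trans (hB _ ⟨0, rfl⟩), fun N => hB _ ⟨N, rfl⟩⟩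

namespace RegLimit
variable {ε : ℝ} {c z : ℕ → ℝ}

lemma pow_mul (h : RegLimit ε c z) (n N : ℕ) : ε ^ n * c N = c N := by
  induction n with
  | zero => simp
  | succ n ih => rw [pow_succ, mul_assoc, h.inv, ih]

lemma tendsto_sub (h : RegLimit ε c z) {r : ℕ} (hr : r ≠ 0) (n : ℕ) :
    Tendsto (fun N => powSum ε r (N - n) - if r = 1 then c N else 0) atTop (𝓝 (z r)) := by
  have h1 : Tendsto (fun N => powSum ε r N - if r = 1 then c N else 0) atTop (𝓝 (z r)) := by
    rcases eq_or_ne r 1 with rfl | h1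
    · simpa using h.lim_one
    · simpa [h1] using h.lim r (by omega)
  have h2 := h1.sub ((tendsto_powSum_add_sub h.sq hr n).comp (tendsto_sub_atTop_nat n))
  rw [sub_zero] at h2
  refine h2.congr' ((eventually_ge_atTop n).mono fun N hN => ?_)
  simp only [Function.comp_apply, Nat.sub_add_cancel hN]
  ring

lemma tendsto_add (h : RegLimit ε c z) {r : ℕ} (hr : r ≠ 0) (n : ℕ) :
    Tendsto (fun N => powSum ε r (n + N) - if r = 1 then c N else 0) atTop (𝓝 (z r)) := by
  have h2 := (h.tendsto_sub hr 0).add (tendsto_powSum_add_sub h.sq hr n)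
  rw [add_zero] at h2
  refine h2.congr fun N => ?_
  rw [Nat.sub_zero, add_comm n]
  ring

end RegLimit

/-- The limit of `oneSided` at the integer `n ≥ 0`. -/
noncomputable def oneLim (ε : ℝ) (z : ℕ → ℝ) (n : ℕ) : PowerSeries ℝ :=
  PowerSeries.mk fun r => if r = 0 then ε ^ n else
    -(-1) ^ r * (ε ^ n * (powSum ε r n + (-1) ^ r * z r))

/-- The limit of `oneSided` at the integer `-(n + 1)`. -/
noncomputable def oneLimNeg (ε : ℝ) (z : ℕ → ℝ) (n : ℕ) : PowerSeries ℝ :=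
  PowerSeries.mk fun r => if r = 0 then 0 else -(ε ^ (n + 1) * (z r - powSum ε r n))

/-- The limit of `oneSidedSq` at the integer `n ≥ 0`. -/
noncomputable def oneSqLim (z : ℕ → ℝ) (n : ℕ) : PowerSeries ℝ :=
  PowerSeries.mk fun r => if r = 0 then 1 else
    ((r : ℝ) - 1) * ((-1) ^ r * (powSum 1 r n + (-1) ^ r * z r))

/-- The limit of `twoSided` at the integers `n` and `-n`. -/
noncomputable def twoLim (ε : ℝ) (z : ℕ → ℝ) (n : ℕ) : PowerSeries ℝ :=
  PowerSeries.mk fun r => if r = 0 then ε ^ n else -(ε ^ n * ((1 + (-1) ^ r) * z r))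

variable {ε : ℝ} {c z : ℕ → ℝ}

lemma coeffTendsto_oneSided (h : RegLimit ε c z) (n : ℕ) :
    CoeffTendsto (fun N => oneSided ε (c N) N n) (oneLim ε z n) := by
  intro r
  rcases eq_or_ne r 0 with rfl | hr
  · refine tendsto_const_nhds.congr' ((eventually_ge_atTop n).mono fun N hN => ?_)
    beta_reduce
    rw [coeff_zero_oneSided _ _ hN]
    simp [oneLim]
  · have h1 := ((((h.tendsto_sub hr n).const_mul ((-1) ^ r)).const_add
      (powSum ε r n)).const_mul (ε ^ n)).const_mul (-(-1) ^ r)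
    rw [oneLim, PowerSeries.coeff_mk, if_neg hr]
    refine h1.congr' ((eventually_ge_atTop n).mono fun N hN => ?_)
    beta_reduce
    rw [coeff_oneSided h.sq _ hr hN]
    rcases eq_or_ne r 1 with rfl | h1
    · simp only [if_true]
      linear_combination h.pow_mul n N
    · simp only [if_neg h1]
      ring

lemma coeffTendsto_oneSided_zero (h : RegLimit ε c z) :
    CoeffTendsto (fun N => oneSided ε (c N) N 0) (oneLim ε z 0) := by
  simpa using coeffTendsto_oneSided h 0

lemma coeffTendsto_oneSided_succ (h : RegLimit ε c z) (n : ℕ) :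
    CoeffTendsto (fun N => oneSided ε (c N) N ((n : ℝ) + 1)) (oneLim ε z (n + 1)) := by
  simpa using coeffTendsto_oneSided h (n + 1)

lemma coeffTendsto_oneSided_neg (h : RegLimit ε c z) (n : ℕ) :
    CoeffTendsto (fun N => oneSided ε (c N) N (-((n : ℝ) + 1))) (oneLimNeg ε z n) := by
  intro r
  rcases eq_or_ne r 0 with rfl | hr
  · simp only [coeff_zero_oneSided_neg]
    simp [oneLimNeg]
  · have h2 := h.tendsto_sub hr 0
    -- The last summand is a null sequence: `oneSided` has `N + 1` poles, so `powSum` is needed at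
    -- `n + (N + 1)` rather than at `n + N`.
    have h1 := ((((h.tendsto_add hr n).add (tendsto_const_nhds (x := -powSum ε r n))).add
      ((tendsto_powSum_add_sub h.sq hr 1).comp
      (tendsto_add_atTop_nat n))).const_mul (ε ^ (n + 1))).neg
    rw [oneLimNeg, PowerSeries.coeff_mk, if_neg hr, sub_eq_add_neg (z r),
      ← add_zero (z r + -powSum ε r n)]
    refine h1.congr fun N => ?_
    rw [coeff_oneSided_neg h.sq _ _ _ hr]
    simp only [Function.comp_apply]
    rw [show N + n + 1 = n + (N + 1) by ring, show N + n = n + N by ring]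
    rcases eq_or_ne r 1 with rfl | h1
    · simp only [if_true]
      linear_combination h.pow_mul (n + 1) N
    · simp only [if_neg h1]
      ring

lemma coeffTendsto_twoSided (h : RegLimit ε c z) (n : ℕ) :
    CoeffTendsto (fun N => twoSided ε N n) (twoLim ε z n) := by
  intro r
  rcases eq_or_ne r 0 with rfl | hr
  · refine tendsto_const_nhds.congr' ((eventually_ge_atTop n).mono fun N hN => ?_)
    beta_reduce
    rw [coeff_zero_twoSided _ hN]
    simp [twoLim]
  · have h1 := ((((h.tendsto_sub hr n).const_mul ((-1) ^ r)).add
      (h.tendsto_add hr n)).const_mul (ε ^ n)).const_mul (-(-1) ^ r)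
    have h2 : PowerSeries.coeff r (twoLim ε z n)
        = -(-1) ^ r * (ε ^ n * ((-1) ^ r * z r + z r)) := by
      rw [twoLim, PowerSeries.coeff_mk, if_neg hr]
      rcases neg_one_pow_eq_or ℝ r with h | h <;> rw [h] <;> ring
    rw [h2]
    refine h1.congr' ((eventually_ge_atTop n).mono fun N hN => ?_)
    beta_reduce
    rw [coeff_twoSided h.sq hr hN]
    rcases eq_or_ne r 1 with rfl | h1
    · ring
    · simp only [if_neg h1]
      ring

lemma coeffTendsto_twoSided_zero (h : RegLimit ε c z) :
    CoeffTendsto (fun N => twoSided ε N 0) (twoLim ε z 0) := by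
  simpa using coeffTendsto_twoSided h 0

lemma coeffTendsto_twoSided_succ (h : RegLimit ε c z) (n : ℕ) :
    CoeffTendsto (fun N => twoSided ε N ((n : ℝ) + 1)) (twoLim ε z (n + 1)) := by
  simpa using coeffTendsto_twoSided h (n + 1)

/-- The parity factor `(-1) ^ r` is harmless because the odd coefficients of the limit vanish. -/
lemma coeffTendsto_twoSided_neg (h : RegLimit ε c z) (n : ℕ) :
    CoeffTendsto (fun N => twoSided ε N (-((n : ℝ) + 1))) (twoLim ε z (n + 1)) := by
  intro r
  have h1 := (coeffTendsto_twoSided_succ h n r).const_mul ((-1) ^ r)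
  have h2 : PowerSeries.coeff r (twoLim ε z (n + 1))
      = (-1) ^ r * PowerSeries.coeff r (twoLim ε z (n + 1)) := by
    rw [twoLim, PowerSeries.coeff_mk]
    rcases eq_or_ne r 0 with rfl | hr
    · simp
    · rw [if_neg hr]
      rcases neg_one_pow_eq_or ℝ r with h | h <;> simp [h]
  rw [h2]
  exact h1.congr fun N => (coeff_twoSided_neg ε r N _).symm

lemma coeffTendsto_oneSidedSq (h : RegLimit 1 c z) (n : ℕ) :
    CoeffTendsto (fun N => oneSidedSq N n) (oneSqLim z n) := by
  intro r
  rcases eq_or_ne r 0 with rfl | hr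
  · refine tendsto_const_nhds.congr' ((eventually_ge_atTop n).mono fun N hN => ?_)
    beta_reduce
    rw [coeff_zero_oneSidedSq hN]
    simp [oneSqLim]
  · have h1 := ((((h.tendsto_sub hr n).const_mul ((-1) ^ r)).const_add
      (powSum 1 r n)).const_mul ((-1) ^ r)).const_mul ((r : ℝ) - 1)
    rw [oneSqLim, PowerSeries.coeff_mk, if_neg hr]
    refine h1.congr' ((eventually_ge_atTop n).mono fun N hN => ?_)
    beta_reduce
    rw [coeff_oneSidedSq hr hN]
    rcases eq_or_ne r 1 with rfl | h1
    · simp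
    · simp only [if_neg h1]
      ring

lemma coeffTendsto_oneSidedSq_zero (h : RegLimit 1 c z) :
    CoeffTendsto (fun N => oneSidedSq N 0) (oneSqLim z 0) := by
  simpa using coeffTendsto_oneSidedSq h 0

lemma coeffTendsto_oneSidedSq_succ (h : RegLimit 1 c z) (n : ℕ) :
    CoeffTendsto (fun N => oneSidedSq N ((n : ℝ) + 1)) (oneSqLim z (n + 1)) := by
  simpa using coeffTendsto_oneSidedSq h (n + 1)

/-! ### Bounds uniform in the truncation. -/

/-- Bounds for the coefficients of positive index yield `CoeffBounded`. -/
lemma coeffBounded_of_le {f : ℕ → ℕ → PowerSeries ℝ}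
    (h0 : ∃ C, ∀ N n, n < N → |PowerSeries.coeff 0 (f N n)| ≤ C)
    (h1 : ∃ C, ∀ N n : ℕ, n < N → |PowerSeries.coeff 1 (f N n)| ≤ C * ((n : ℝ) + 1))
    (h2 : ∀ r, 2 ≤ r → ∃ C, 0 ≤ C ∧ ∀ N n, n < N → |PowerSeries.coeff r (f N n)| ≤ C) :
    CoeffBounded (fun n => (n : ℝ) + 1) f := by
  intro r
  rcases r with _ | _ | r
  · simpa using h0
  · simpa using h1
  · obtain ⟨C, hC0, hC⟩ := h2 (r + 2) (by omega)
    refine ⟨C, fun N n hn => (hC N n hn).trans (le_mul_of_one_le_right hC0 (one_le_pow₀ ?_))⟩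
    linarith [Nat.cast_nonneg (α := ℝ) n]

lemma abs_neg_one_pow_mul (r : ℕ) (x : ℝ) : |(-1) ^ r * x| = |x| := by
  rw [abs_mul, abs_neg_one_pow, one_mul]

lemma abs_neg_neg_one_pow_mul (r : ℕ) (x : ℝ) : |-(-1) ^ r * x| = |x| := by
  rw [neg_mul, abs_neg, abs_neg_one_pow_mul]

lemma abs_pow_mul_of_sq (hε : ε * ε = 1) (n : ℕ) (x : ℝ) : |ε ^ n * x| = |x| := by
  rw [abs_mul, abs_pow_of_sq hε, one_mul]

lemma coeffBounded_oneSided (h : RegLimit ε c z) :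
    CoeffBounded (fun n => (n : ℝ) + 1) (fun N n => oneSided ε (c N) N ((n : ℝ) + 1)) := by
  have hcast : ∀ n : ℕ, (n : ℝ) + 1 = ((n + 1 : ℕ) : ℝ) := fun n => by push_cast; rfl
  refine coeffBounded_of_le ⟨1, fun N n hn => ?_⟩ ?_ fun r hr => ?_
  · rw [hcast, coeff_zero_oneSided _ _ hn, abs_pow_of_sq h.sq]
  · obtain ⟨B, hB0, hB⟩ := exists_abs_le_of_tendsto h.lim_one
    refine ⟨B + 2, fun N n hn => ?_⟩
    rw [hcast, coeff_oneSided h.sq _ one_ne_zero hn, if_pos rfl, ← h.pow_mul (n + 1) N]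
    -- The divergent parts cancel: what remains is two blocks of `n + 1` consecutive terms, each
    -- bounded by `n + 1`, and the bounded sequence `powSum ε 1 N - c N`. Linear growth suffices for
    -- the summability needed later.
    have e : -(-1) ^ 1 * (ε ^ (n + 1) * (powSum ε 1 (n + 1) + (-1) ^ 1 * powSum ε 1 (N - (n + 1))))
        + ε ^ (n + 1) * c N = ε ^ (n + 1) * ((powSum ε 1 (0 + (n + 1)) - powSum ε 1 0)
          + (powSum ε 1 (N - (n + 1) + (n + 1)) - powSum ε 1 (N - (n + 1)))
          - (powSum ε 1 N - c N)) := by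
      rw [Nat.sub_add_cancel hn, zero_add, powSum_zero]
      ring
    rw [e, abs_pow_mul_of_sq h.sq]
    have h1 := abs_powSum_add_sub_le h.sq 1 0 (n + 1)
    have h2 := abs_powSum_add_sub_le h.sq 1 (N - (n + 1)) (n + 1)
    have h3 := hB N
    have h4 : (1 : ℝ) ≤ ((n + 1 : ℕ) : ℝ) := by simp
    refine (abs_sub _ _).trans ((add_le_add (abs_add_le _ _) le_rfl).trans ?_)
    nlinarith
  · obtain ⟨B, hB0, hB⟩ := exists_abs_le_of_tendsto (h.lim r hr)
    refine ⟨B + B, by linarith, fun N n hn => ?_⟩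
    rw [hcast, coeff_oneSided h.sq _ (by omega) hn, if_neg (by omega), add_zero,
      abs_neg_neg_one_pow_mul, abs_pow_mul_of_sq h.sq]
    refine (abs_add_le _ _).trans (add_le_add (hB _) ?_)
    rw [abs_neg_one_pow_mul]
    exact hB _

lemma coeffBounded_oneSided_neg (h : RegLimit ε c z) :
    CoeffBounded (fun n => (n : ℝ) + 1) (fun N n => oneSided ε (c N) N (-((n : ℝ) + 1))) := by
  refine coeffBounded_of_le ⟨1, fun N n hn => ?_⟩ ?_ fun r hr => ?_
  · rw [coeff_zero_oneSided_neg, abs_zero]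
    exact zero_le_one
  · obtain ⟨B, hB0, hB⟩ := exists_abs_le_of_tendsto h.lim_one
    refine ⟨B + 2, fun N n hn => ?_⟩
    rw [coeff_oneSided_neg h.sq _ _ _ one_ne_zero, if_pos rfl, ← h.pow_mul (n + 1) N]
    have e : -(ε ^ (n + 1) * (powSum ε 1 (n + (N + 1)) - powSum ε 1 n))
        + ε ^ (n + 1) * c N = ε ^ (n + 1) * ((powSum ε 1 (0 + n) - powSum ε 1 0)
          - (powSum ε 1 (N + (n + 1)) - powSum ε 1 N)
          - (powSum ε 1 N - c N)) := by
      rw [zero_add, powSum_zero, show n + (N + 1) = N + (n + 1) by ring]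
      ring
    rw [e, abs_pow_mul_of_sq h.sq]
    have h1 := abs_powSum_add_sub_le h.sq 1 0 n
    have h2 := abs_powSum_add_sub_le h.sq 1 N (n + 1)
    have h3 := hB N
    have h4 : (0 : ℝ) ≤ (n : ℝ) := Nat.cast_nonneg n
    push_cast at h2
    refine (abs_sub _ _).trans ((add_le_add (abs_sub _ _) le_rfl).trans ?_)
    nlinarith
  · obtain ⟨B, hB0, hB⟩ := exists_abs_le_of_tendsto (h.lim r hr)
    refine ⟨B + B, by linarith, fun N n hn => ?_⟩
    rw [coeff_oneSided_neg h.sq _ _ _ (by omega), if_neg (by omega), add_zero, abs_neg,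
      abs_pow_mul_of_sq h.sq]
    exact (abs_sub _ _).trans (add_le_add (hB _) (hB _))

lemma coeffBounded_twoSided (h : RegLimit ε c z) :
    CoeffBounded (fun n => (n : ℝ) + 1) (fun N n => twoSided ε N ((n : ℝ) + 1)) := by
  have hcast : ∀ n : ℕ, (n : ℝ) + 1 = ((n + 1 : ℕ) : ℝ) := fun n => by push_cast; rfl
  refine coeffBounded_of_le ⟨1, fun N n hn => ?_⟩ ?_ fun r hr => ?_
  · rw [hcast, coeff_zero_twoSided _ hn, abs_pow_of_sq h.sq]
  · refine ⟨2, fun N n hn => ?_⟩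
    rw [hcast, coeff_twoSided h.sq one_ne_zero hn, abs_neg_neg_one_pow_mul,
      abs_pow_mul_of_sq h.sq]
    have e : powSum ε 1 (n + 1 + N) + (-1) ^ 1 * powSum ε 1 (N - (n + 1))
        = (powSum ε 1 (N + (n + 1)) - powSum ε 1 N)
          + (powSum ε 1 (N - (n + 1) + (n + 1)) - powSum ε 1 (N - (n + 1))) := by
      rw [Nat.sub_add_cancel hn, add_comm N]
      ring
    rw [e]
    have h1 := abs_powSum_add_sub_le h.sq 1 N (n + 1)
    have h2 := abs_powSum_add_sub_le h.sq 1 (N - (n + 1)) (n + 1)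
    refine (abs_add_le _ _).trans ?_
    linarith
  · obtain ⟨B, hB0, hB⟩ := exists_abs_le_of_tendsto (h.lim r hr)
    refine ⟨B + B, by linarith, fun N n hn => ?_⟩
    rw [hcast, coeff_twoSided h.sq (by omega) hn, abs_neg_neg_one_pow_mul,
      abs_pow_mul_of_sq h.sq]
    refine (abs_add_le _ _).trans (add_le_add (hB _) ?_)
    rw [abs_neg_one_pow_mul]
    exact hB _

lemma coeffBounded_twoSided_neg (h : RegLimit ε c z) :
    CoeffBounded (fun n => (n : ℝ) + 1) (fun N n => twoSided ε N (-((n : ℝ) + 1))) := by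
  intro r
  obtain ⟨C, hC⟩ := coeffBounded_twoSided h r
  refine ⟨C, fun N n hn => ?_⟩
  rw [coeff_twoSided_neg, abs_neg_one_pow_mul]
  exact hC N n hn

/-- As the coefficient of index `1` vanishes, there is no growth in `n`; the square of this kernel
over `s ^ 3` is controlled only because of this. -/
lemma coeffBounded_oneSidedSq (h : RegLimit 1 c z) :
    CoeffBounded (fun _ => 1) (fun N n => oneSidedSq N ((n : ℝ) + 1)) := by
  have hcast : ∀ n : ℕ, (n : ℝ) + 1 = ((n + 1 : ℕ) : ℝ) := fun n => by push_cast; rfl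
  intro r
  simp only [one_pow, mul_one]
  rcases r with _ | _ | r
  · refine ⟨1, fun N n hn => ?_⟩
    rw [hcast, coeff_zero_oneSidedSq hn, abs_one]
  · refine ⟨0, fun N n hn => ?_⟩
    rw [hcast, coeff_oneSidedSq (by omega) hn]
    simp
  · obtain ⟨B, hB0, hB⟩ := exists_abs_le_of_tendsto (h.lim (r + 2) (by omega))
    refine ⟨|((r + 2 : ℕ) : ℝ) - 1| * (B + B), fun N n hn => ?_⟩
    rw [hcast, coeff_oneSidedSq (by omega) hn, abs_mul, abs_neg_one_pow_mul]
    refine mul_le_mul_of_nonneg_left ?_ (abs_nonneg _)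
    refine (abs_add_le _ _).trans (add_le_add (hB _) ?_)
    rw [abs_neg_one_pow_mul]
    exact hB _

lemma CoeffBounded.mono {h h' : ℕ → ℝ} {f : ℕ → ℕ → PowerSeries ℝ} (hh : ∀ n, 0 < h n)
    (hle : ∀ n, h n ≤ h' n) (hf : CoeffBounded h f) : CoeffBounded h' f := by
  intro r
  obtain ⟨C, hC⟩ := hf r
  refine ⟨C, fun N n hn => (hC N n hn).trans ?_⟩
  have h1 : 0 ≤ C := nonneg_of_mul_nonneg_left ((abs_nonneg _).trans (hC N n hn))
    (pow_pos (hh n) r)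
  exact mul_le_mul_of_nonneg_left (pow_le_pow_left₀ (hh n).le (hle n) r) h1

/-! ### Low coefficients of products and of `invSeries d ^ m`. -/

section coeff
variable (f g : PowerSeries ℝ)

lemma coeff_zero_mul' : PowerSeries.coeff 0 (f * g)
    = PowerSeries.coeff 0 f * PowerSeries.coeff 0 g := by
  simp [PowerSeries.coeff_mul]

lemma coeff_one_mul' : PowerSeries.coeff 1 (f * g)
    = PowerSeries.coeff 0 f * PowerSeries.coeff 1 g
      + PowerSeries.coeff 1 f * PowerSeries.coeff 0 g := by
  rw [PowerSeries.coeff_mul, Nat.sum_antidiagonal_eq_sum_range_succ_mk]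
  simp only [sum_range_succ, sum_range_zero]
  norm_num only [zero_add]

lemma coeff_two_mul' : PowerSeries.coeff 2 (f * g)
    = PowerSeries.coeff 0 f * PowerSeries.coeff 2 g
      + PowerSeries.coeff 1 f * PowerSeries.coeff 1 g
      + PowerSeries.coeff 2 f * PowerSeries.coeff 0 g := by
  rw [PowerSeries.coeff_mul, Nat.sum_antidiagonal_eq_sum_range_succ_mk]
  simp only [sum_range_succ, sum_range_zero]
  norm_num only [zero_add]

lemma coeff_three_mul' : PowerSeries.coeff 3 (f * g)
    = PowerSeries.coeff 0 f * PowerSeries.coeff 3 g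
      + PowerSeries.coeff 1 f * PowerSeries.coeff 2 g
      + PowerSeries.coeff 2 f * PowerSeries.coeff 1 g
      + PowerSeries.coeff 3 f * PowerSeries.coeff 0 g := by
  rw [PowerSeries.coeff_mul, Nat.sum_antidiagonal_eq_sum_range_succ_mk]
  simp only [sum_range_succ, sum_range_zero]
  norm_num only [zero_add]

lemma coeff_four_mul' : PowerSeries.coeff 4 (f * g)
    = PowerSeries.coeff 0 f * PowerSeries.coeff 4 g
      + PowerSeries.coeff 1 f * PowerSeries.coeff 3 g
      + PowerSeries.coeff 2 f * PowerSeries.coeff 2 g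
      + PowerSeries.coeff 3 f * PowerSeries.coeff 1 g
      + PowerSeries.coeff 4 f * PowerSeries.coeff 0 g := by
  rw [PowerSeries.coeff_mul, Nat.sum_antidiagonal_eq_sum_range_succ_mk]
  simp only [sum_range_succ, sum_range_zero]
  norm_num only [zero_add]

lemma coeff_five_mul' : PowerSeries.coeff 5 (f * g)
    = PowerSeries.coeff 0 f * PowerSeries.coeff 5 g
      + PowerSeries.coeff 1 f * PowerSeries.coeff 4 g
      + PowerSeries.coeff 2 f * PowerSeries.coeff 3 g
      + PowerSeries.coeff 3 f * PowerSeries.coeff 2 g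
      + PowerSeries.coeff 4 f * PowerSeries.coeff 1 g
      + PowerSeries.coeff 5 f * PowerSeries.coeff 0 g := by
  rw [PowerSeries.coeff_mul, Nat.sum_antidiagonal_eq_sum_range_succ_mk]
  simp only [sum_range_succ, sum_range_zero]
  norm_num only [zero_add]

lemma coeff_six_mul' : PowerSeries.coeff 6 (f * g)
    = PowerSeries.coeff 0 f * PowerSeries.coeff 6 g
      + PowerSeries.coeff 1 f * PowerSeries.coeff 5 g
      + PowerSeries.coeff 2 f * PowerSeries.coeff 4 g
      + PowerSeries.coeff 3 f * PowerSeries.coeff 3 g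
      + PowerSeries.coeff 4 f * PowerSeries.coeff 2 g
      + PowerSeries.coeff 5 f * PowerSeries.coeff 1 g
      + PowerSeries.coeff 6 f * PowerSeries.coeff 0 g := by
  rw [PowerSeries.coeff_mul, Nat.sum_antidiagonal_eq_sum_range_succ_mk]
  simp only [sum_range_succ, sum_range_zero]
  norm_num only [zero_add]

end coeff

lemma coeff_zero_invSeries_pow (d : ℝ) (m : ℕ) :
    PowerSeries.coeff 0 (invSeries d ^ m) = 1 / d ^ m := by
  rw [coeff_invSeries_pow, add_zero]
  simp [invSeries]

lemma coeff_one_invSeries_pow (d : ℝ) (m : ℕ) :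
    PowerSeries.coeff 1 (invSeries d ^ m) = -m / d ^ (m + 1) := by
  have h : PowerSeries.coeff 1 (invSeries 1 ^ m) = -(m : ℝ) := by
    induction m with
    | zero => simp [PowerSeries.coeff_one]
    | succ m ih =>
      rw [pow_succ, coeff_one_mul', ih, coeff_zero_invSeries_pow]
      simp [invSeries]
  rw [coeff_invSeries_pow, h]

lemma coeff_two_invSeries_pow (d : ℝ) (m : ℕ) :
    PowerSeries.coeff 2 (invSeries d ^ m) = m * (m + 1) / 2 / d ^ (m + 2) := by
  have h : PowerSeries.coeff 2 (invSeries 1 ^ m) = (m : ℝ) * (m + 1) / 2 := by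
    induction m with
    | zero => simp [PowerSeries.coeff_one]
    | succ m ih =>
      rw [pow_succ, coeff_two_mul', ih, coeff_zero_invSeries_pow, coeff_one_invSeries_pow]
      simp [invSeries]
      ring
  rw [coeff_invSeries_pow, h]

lemma coeff_three_invSeries_pow (d : ℝ) (m : ℕ) :
    PowerSeries.coeff 3 (invSeries d ^ m) = -(m * (m + 1) * (m + 2)) / 6 / d ^ (m + 3) := by
  have h : PowerSeries.coeff 3 (invSeries 1 ^ m) = -((m : ℝ) * (m + 1) * (m + 2)) / 6 := by
    induction m with
    | zero => simp [PowerSeries.coeff_one]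
    | succ m ih =>
      rw [pow_succ, coeff_three_mul', ih, coeff_zero_invSeries_pow, coeff_one_invSeries_pow,
        coeff_two_invSeries_pow]
      simp [invSeries]
      ring
  rw [coeff_invSeries_pow, h]

lemma summable_one_div_succ_pow {k : ℕ} (hk : 2 ≤ k) :
    Summable fun n : ℕ => 1 / ((n : ℝ) + 1) ^ k := (zetaVal_spec hk).2.summable

lemma summable_growth {J m : ℕ} (h : J + 2 ≤ m) :
    Summable fun n : ℕ => ((n : ℝ) + 1) ^ J / ((n : ℝ) + 1) ^ m := by
  obtain ⟨k, rfl⟩ := Nat.exists_eq_add_of_le h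
  refine (summable_one_div_succ_pow (k := 2 + k) (by omega)).congr fun n => ?_
  have : (n : ℝ) + 1 ≠ 0 := by positivity
  rw [add_assoc, pow_add _ J]
  field_simp

lemma one_le_succ (n : ℕ) : (1 : ℝ) ≤ (n : ℝ) + 1 := by linarith [Nat.cast_nonneg (α := ℝ) n]

/-! ### Residue identities for the kernels in use. -/

variable {ε₁ ε₂ : ℝ} {c₁ c₂ z₁ z₂ : ℕ → ℝ}

/-- The one-sided factors are regular at negative integers, so the poles are triple at `n + 1` and
simple at `-(n + 1)`. The common index `2` reflects the normalization by `(s - p) ^ 3` at both. -/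
lemma hasSum_twoSided_mul_mul (h : RegLimit ε c z) (h₁ : RegLimit ε₁ c₁ z₁)
    (h₂ : RegLimit ε₂ c₂ z₂) :
    HasSum (fun n : ℕ =>
      PowerSeries.coeff 2 (twoLim ε z (n + 1) * oneLim ε₁ z₁ (n + 1) * oneLim ε₂ z₂ (n + 1)
          * invSeries ((n : ℝ) + 1) ^ 4)
        + PowerSeries.coeff 2 (twoLim ε z (n + 1) * oneLimNeg ε₁ z₁ n * oneLimNeg ε₂ z₂ n
          * invSeries (-((n : ℝ) + 1)) ^ 4))
      (-PowerSeries.coeff (2 + 4) (twoLim ε z 0 * oneLim ε₁ z₁ 0 * oneLim ε₂ z₂ 0)) := by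
  have hφ : ∀ N, (fun p => twoSided ε N p * oneSided ε₁ (c₁ N) N p * oneSided ε₂ (c₂ N) N p) ∈
      polarSpan (intPoints N) (2 + 1) 0 := fun N => by
    simpa only [Nat.reduceAdd] using mul_mem_polarSpan (mul_mem_polarSpan (twoSided_mem_polarSpan ε N)
      (oneSided_mem_polarSpan (fun _ => natCast_mem_intPoints) _ _))
      (oneSided_mem_polarSpan (fun _ => natCast_mem_intPoints) _ _)
  have hb := ((coeffBounded_twoSided h).mul (coeffBounded_oneSided h₁)).mul
    (coeffBounded_oneSided h₂)
  have hb' := ((coeffBounded_twoSided_neg h).mul (coeffBounded_oneSided_neg h₁)).mul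
    (coeffBounded_oneSided_neg h₂)
  have hg := fun n => ((coeffTendsto_twoSided_succ h n).mul (coeffTendsto_oneSided_succ h₁ n)).mul
    (coeffTendsto_oneSided_succ h₂ n)
  have hg' := fun n => ((coeffTendsto_twoSided_neg h n).mul (coeffTendsto_oneSided_neg h₁ n)).mul
    (coeffTendsto_oneSided_neg h₂ n)
  have h0 := ((coeffTendsto_twoSided_zero h).mul (coeffTendsto_oneSided_zero h₁)).mul
    (coeffTendsto_oneSided_zero h₂)
  exact hasSum_residue_intPoints one_le_succ (by norm_num) hφ hg hb hg' hb' h0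
    (summable_growth (by norm_num))

lemma hasSum_twoSided_mul (h : RegLimit ε c z) (h₁ : RegLimit ε₁ c₁ z₁) :
    HasSum (fun n : ℕ =>
      PowerSeries.coeff 1 (twoLim ε z (n + 1) * oneLim ε₁ z₁ (n + 1)
          * invSeries ((n : ℝ) + 1) ^ 4)
        + PowerSeries.coeff 1 (twoLim ε z (n + 1) * oneLimNeg ε₁ z₁ n
          * invSeries (-((n : ℝ) + 1)) ^ 4))
      (-PowerSeries.coeff (1 + 4) (twoLim ε z 0 * oneLim ε₁ z₁ 0)) :=
  hasSum_residue_intPoints (h := fun n => (n : ℝ) + 1) (J := 1) (m := 4) (k := 0 + 0)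
    (φ := fun N p => twoSided ε N p * oneSided ε₁ (c₁ N) N p)
    one_le_succ (by norm_num)
    (fun N => mul_mem_polarSpan (twoSided_mem_polarSpan ε N)
      (oneSided_mem_polarSpan (fun _ => natCast_mem_intPoints) _ _))
    (fun n => (coeffTendsto_twoSided_succ h n).mul (coeffTendsto_oneSided_succ h₁ n))
    ((coeffBounded_twoSided h).mul (coeffBounded_oneSided h₁))
    (fun n => (coeffTendsto_twoSided_neg h n).mul (coeffTendsto_oneSided_neg h₁ n))
    ((coeffBounded_twoSided_neg h).mul (coeffBounded_oneSided_neg h₁))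
    ((coeffTendsto_twoSided_zero h).mul (coeffTendsto_oneSided_zero h₁))
    (summable_growth (by norm_num))

lemma hasSum_oneSided_mul (h₁ : RegLimit ε₁ c₁ z₁) (h₂ : RegLimit ε₂ c₂ z₂) {m : ℕ}
    (hm : 3 ≤ m) :
    HasSum (fun n : ℕ =>
      PowerSeries.coeff 1 (oneLim ε₁ z₁ (n + 1) * oneLim ε₂ z₂ (n + 1)
          * invSeries ((n : ℝ) + 1) ^ m))
      (-PowerSeries.coeff (1 + m) (oneLim ε₁ z₁ 0 * oneLim ε₂ z₂ 0)) :=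
  hasSum_residue_natPoints (h := fun n => (n : ℝ) + 1) (J := 1) (m := m) (k := 0 + 0)
    (φ := fun N p => oneSided ε₁ (c₁ N) N p * oneSided ε₂ (c₂ N) N p)
    one_le_succ (by omega)
    (fun N => mul_mem_polarSpan (oneSided_mem_polarSpan (fun _ => natCast_mem_natPoints) _ _)
      (oneSided_mem_polarSpan (fun _ => natCast_mem_natPoints) _ _))
    (fun n => (coeffTendsto_oneSided_succ h₁ n).mul (coeffTendsto_oneSided_succ h₂ n))
    ((coeffBounded_oneSided h₁).mul (coeffBounded_oneSided h₂))
    ((coeffTendsto_oneSided_zero h₁).mul (coeffTendsto_oneSided_zero h₂))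
    (summable_growth (by omega))

lemma hasSum_oneSidedSq_mul (h₁ : RegLimit 1 c₁ z₁) (h₂ : RegLimit ε₂ c₂ z₂) :
    HasSum (fun n : ℕ =>
      PowerSeries.coeff 2 (oneSqLim z₁ (n + 1) * oneLim ε₂ z₂ (n + 1)
          * invSeries ((n : ℝ) + 1) ^ 4))
      (-PowerSeries.coeff (2 + 4) (oneSqLim z₁ 0 * oneLim ε₂ z₂ 0)) :=
  hasSum_residue_natPoints (h := fun n => (n : ℝ) + 1) (J := 2) (m := 4) (k := 0 + 0)
    (φ := fun N p => oneSidedSq N p * oneSided ε₂ (c₂ N) N p)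
    one_le_succ (by omega)
    (fun N => mul_mem_polarSpan (oneSidedSq_mem_polarSpan (fun _ => natCast_mem_natPoints))
      (oneSided_mem_polarSpan (fun _ => natCast_mem_natPoints) _ _))
    (fun n => (coeffTendsto_oneSidedSq_succ h₁ n).mul (coeffTendsto_oneSided_succ h₂ n))
    (((coeffBounded_oneSidedSq h₁).mono (fun _ => one_pos) one_le_succ).mul
      (coeffBounded_oneSided h₂))
    ((coeffTendsto_oneSidedSq_zero h₁).mul (coeffTendsto_oneSided_zero h₂))
    (summable_growth (by norm_num))

lemma hasSum_oneSidedSq_mul_self (h₁ : RegLimit 1 c₁ z₁) :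
    HasSum (fun n : ℕ =>
      PowerSeries.coeff 3 (oneSqLim z₁ (n + 1) * oneSqLim z₁ (n + 1)
          * invSeries ((n : ℝ) + 1) ^ 3))
      (-PowerSeries.coeff (3 + 3) (oneSqLim z₁ 0 * oneSqLim z₁ 0)) := by
  have hφ : ∀ N, (fun p => oneSidedSq N p * oneSidedSq N p) ∈
      polarSpan (natPoints N) (3 + 1) 0 := fun N => by
    simpa only [Nat.reduceAdd] using mul_mem_polarSpan (oneSidedSq_mem_polarSpan (fun _ => natCast_mem_natPoints))
      (oneSidedSq_mem_polarSpan (fun _ => natCast_mem_natPoints))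
  have hb := (coeffBounded_oneSidedSq h₁).mul (coeffBounded_oneSidedSq h₁)
  have hg := fun n => (coeffTendsto_oneSidedSq_succ h₁ n).mul (coeffTendsto_oneSidedSq_succ h₁ n)
  have h0 := (coeffTendsto_oneSidedSq_zero h₁).mul (coeffTendsto_oneSidedSq_zero h₁)
  exact hasSum_residue_natPoints (fun _ => le_rfl) (by norm_num) hφ hg hb h0
    (by simpa using summable_one_div_succ_pow (k := 3) (by norm_num))

/-! ### The two regularized limits, for the signs `1` and `-1`. -/

/-- The limits of the partial sums `∑ 1 / i^r`, regularized to `0` for `r = 1`. -/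
noncomputable def zetaReg (r : ℕ) : ℝ := if r = 1 then 0 else zetaVal r

/-- The sums `∑ (-1)^i / i^r`. -/
noncomputable def altZeta (r : ℕ) : ℝ :=
  if r = 1 then -Real.log 2 else (2 / 2 ^ r - 1) * zetaVal r

lemma tendsto_powSum_one {r : ℕ} (hr : 2 ≤ r) :
    Tendsto (powSum 1 r) atTop (𝓝 (zetaVal r)) := by
  refine (zetaVal_spec hr).2.tendsto_sum_nat.congr fun N => ?_
  simp [powSum]

/-- An alternating sum is twice its even-indexed part minus the full sum. -/
lemma powSum_neg_one_two_mul (r M : ℕ) :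
    powSum (-1) r (2 * M) = 2 / 2 ^ r * powSum 1 r M - powSum 1 r (2 * M) := by
  induction M with
  | zero => simp [powSum_zero]
  | succ M ih =>
    rw [show 2 * (M + 1) = 2 * M + 1 + 1 by ring]
    simp only [powSum_succ, one_pow, ih]
    have h1 : (-1 : ℝ) ^ (2 * M + 1) = -1 := by rw [pow_succ, pow_mul]; norm_num
    have h2 : (-1 : ℝ) ^ (2 * M + 1 + 1) = 1 := by rw [pow_succ, h1]; norm_num
    have h3 : (((2 * M + 1 : ℕ) : ℝ) + 1) ^ r = 2 ^ r * ((M : ℝ) + 1) ^ r := by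
      rw [← mul_pow]; push_cast; ring
    rw [h1, h2, h3]
    field_simp
    ring

lemma tendsto_of_tendsto_two_mul {u : ℕ → ℝ} {a : ℝ}
    (h : Tendsto (fun M => u (2 * M)) atTop (𝓝 a))
    (hd : Tendsto (fun M => u (M + 1) - u M) atTop (𝓝 0)) : Tendsto u atTop (𝓝 a) := by
  rw [Metric.tendsto_atTop] at h hd ⊢
  intro e he
  obtain ⟨A, hA⟩ := h (e / 2) (by positivity)
  obtain ⟨B, hB⟩ := hd (e / 2) (by positivity)
  refine ⟨2 * A + B + 1, fun n hn => ?_⟩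
  obtain ⟨k, rfl | rfl⟩ := Nat.even_or_odd' n
  · exact (hA k (by omega)).trans (by linarith)
  · have h1 := hA k (by omega)
    have h2 := hB (2 * k) (by omega)
    rw [Real.dist_eq] at h1 h2 ⊢
    have h3 := abs_add_le (u (2 * k) - a) (u (2 * k + 1) - u (2 * k) - 0)
    rw [show u (2 * k) - a + (u (2 * k + 1) - u (2 * k) - 0) = u (2 * k + 1) - a by ring] at h3
    linarith

lemma powSum_one_one (M : ℕ) : powSum 1 1 M = (harmonic M : ℝ) := by
  rw [harmonic]
  push_cast
  simp [powSum]

/-- For `r = 1` the even partial sums are `H_M - H_{2M}`; Euler's constant cancels and `-log 2`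
remains. -/
lemma tendsto_powSum_neg_one {r : ℕ} (hr : r ≠ 0) :
    Tendsto (powSum (-1) r) atTop (𝓝 (altZeta r)) := by
  refine tendsto_of_tendsto_two_mul ?_ (tendsto_powSum_add_sub (by norm_num) hr 1)
  have hmul : Tendsto (fun M : ℕ => 2 * M) atTop atTop :=
    tendsto_id.const_mul_atTop' (by norm_num)
  simp only [powSum_neg_one_two_mul]
  rcases eq_or_ne r 1 with rfl | h1
  · have h := Real.tendsto_harmonic_sub_log
    have h2 := (h.sub (h.comp hmul)).sub (tendsto_const_nhds (x := Real.log 2))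
    rw [sub_self, zero_sub] at h2
    rw [altZeta, if_pos rfl]
    refine h2.congr' ((eventually_gt_atTop 0).mono fun M hM => ?_)
    have hM' : (M : ℝ) ≠ 0 := by exact_mod_cast hM.ne'
    simp only [Function.comp_apply, powSum_one_one]
    push_cast
    rw [Real.log_mul two_ne_zero hM']
    ring
  · have h := tendsto_powSum_one (r := r) (by omega)
    rw [altZeta, if_neg h1, sub_mul, one_mul]
    exact (h.const_mul _).sub (h.comp hmul)

/-- Subtracting `H_N` itself instead of `log N` makes the regularized value `0`, so Euler's constant
never appears. -/
lemma regLimit_one : RegLimit 1 (powSum 1 1) zetaReg where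
  sq := by norm_num
  inv _ := one_mul _
  lim_one := by simp [zetaReg]
  lim r hr := by
    rw [zetaReg, if_neg (by omega)]
    exact tendsto_powSum_one hr

lemma regLimit_neg_one : RegLimit (-1) (fun _ => 0) altZeta where
  sq := by norm_num
  inv _ := mul_zero _
  lim_one := by simpa using tendsto_powSum_neg_one one_ne_zero
  lim _ hr := tendsto_powSum_neg_one (by omega)

/-! ### Coefficients of the limit kernels. -/

lemma zetaStarTerm_eq (ε : ℝ) (p : ℕ) (δ : ℝ) (q n : ℕ) :
    zetaStarTerm ε p δ q n = ε ^ (n + 1) / ((n : ℝ) + 1) ^ p * powSum δ q (n + 1) := rfl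

lemma abs_eq_one_of_sq {ε : ℝ} (h : ε * ε = 1) : |ε| = 1 := by
  simpa using abs_pow_of_sq h 1

lemma hasSum_zetaStar {ε δ : ℝ} (hε : ε * ε = 1) (hδ : δ * δ = 1) {p : ℕ} (hp : 3 ≤ p) (q : ℕ) :
    HasSum (zetaStarTerm ε p δ q) (zetaStar ε p δ q) :=
  (summable_zetaStarTerm (abs_eq_one_of_sq hε) (abs_eq_one_of_sq hδ) hp q).hasSum

variable {δ δ₁ δ₂ : ℝ} {c₃ c₄ c₅ z₃ z₄ z₅ : ℕ → ℝ}

lemma RegLimit.hasSum (h : RegLimit ε c z) {k : ℕ} (hk : 2 ≤ k) :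
    HasSum (fun n : ℕ => ε ^ (n + 1) / ((n : ℝ) + 1) ^ k) (z k) := by
  have hs : Summable (fun n : ℕ => ε ^ (n + 1) / ((n : ℝ) + 1) ^ k) := by
    refine Summable.of_norm_bounded (summable_one_div_succ_pow hk) fun n => le_of_eq ?_
    rw [Real.norm_eq_abs, abs_div, abs_pow_of_sq h.sq, abs_of_pos (by positivity)]
  exact (hs.hasSum_iff_tendsto_nat).mpr (h.lim k hk)

lemma coeff_oneLim_zero {r : ℕ} (hr : r ≠ 0) (ε : ℝ) (z : ℕ → ℝ) :
    PowerSeries.coeff r (oneLim ε z 0) = -z r := by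
  rw [oneLim, PowerSeries.coeff_mk, if_neg hr, powSum_zero]
  rcases neg_one_pow_eq_or ℝ r with h | h <;> rw [h] <;> ring

lemma coeff_zero_oneLim (ε : ℝ) (z : ℕ → ℝ) (n : ℕ) :
    PowerSeries.coeff 0 (oneLim ε z n) = ε ^ n := by simp [oneLim]

lemma coeff_one_oneLim (ε : ℝ) (z : ℕ → ℝ) (n : ℕ) :
    PowerSeries.coeff 1 (oneLim ε z n) = ε ^ n * (powSum ε 1 n - z 1) := by
  rw [oneLim, PowerSeries.coeff_mk, if_neg one_ne_zero]
  ring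

lemma coeff_two_oneLim (ε : ℝ) (z : ℕ → ℝ) (n : ℕ) :
    PowerSeries.coeff 2 (oneLim ε z n) = -(ε ^ n * (powSum ε 2 n + z 2)) := by
  simp [oneLim]

lemma coeff_zero_oneLimNeg (ε : ℝ) (z : ℕ → ℝ) (n : ℕ) :
    PowerSeries.coeff 0 (oneLimNeg ε z n) = 0 := by simp [oneLimNeg]

lemma coeff_one_oneLimNeg (ε : ℝ) (z : ℕ → ℝ) (n : ℕ) :
    PowerSeries.coeff 1 (oneLimNeg ε z n)
      = ε ^ (n + 1) * (powSum ε 1 (n + 1) - ε ^ (n + 1) / ((n : ℝ) + 1) - z 1) := by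
  rw [powSum_succ]
  simp [oneLimNeg]
  ring

lemma coeff_twoLim_of_odd {r : ℕ} (hr : Odd r) (ε : ℝ) (z : ℕ → ℝ) (n : ℕ) :
    PowerSeries.coeff r (twoLim ε z n) = 0 := by
  rw [twoLim, PowerSeries.coeff_mk, if_neg (by rintro rfl; simp at hr), hr.neg_one_pow]
  ring

lemma coeff_twoLim_of_even {r : ℕ} (hr : Even r) (h0 : r ≠ 0) (ε : ℝ) (z : ℕ → ℝ) (n : ℕ) :
    PowerSeries.coeff r (twoLim ε z n) = -(2 * ε ^ n * z r) := by
  rw [twoLim, PowerSeries.coeff_mk, if_neg h0, hr.neg_one_pow]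
  ring

lemma coeff_zero_twoLim (ε : ℝ) (z : ℕ → ℝ) (n : ℕ) :
    PowerSeries.coeff 0 (twoLim ε z n) = ε ^ n := by simp [twoLim]

lemma coeff_one_twoLim (ε : ℝ) (z : ℕ → ℝ) (n : ℕ) :
    PowerSeries.coeff 1 (twoLim ε z n) = 0 := coeff_twoLim_of_odd odd_one ε z n

lemma coeff_two_twoLim (ε : ℝ) (z : ℕ → ℝ) (n : ℕ) :
    PowerSeries.coeff 2 (twoLim ε z n) = -(2 * ε ^ n * z 2) :=
  coeff_twoLim_of_even even_two two_ne_zero ε z n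

lemma coeff_three_twoLim (ε : ℝ) (z : ℕ → ℝ) (n : ℕ) :
    PowerSeries.coeff 3 (twoLim ε z n) = 0 := coeff_twoLim_of_odd (by decide) ε z n

lemma coeff_four_twoLim (ε : ℝ) (z : ℕ → ℝ) (n : ℕ) :
    PowerSeries.coeff 4 (twoLim ε z n) = -(2 * ε ^ n * z 4) :=
  coeff_twoLim_of_even (by decide) (by decide) ε z n

lemma coeff_five_twoLim (ε : ℝ) (z : ℕ → ℝ) (n : ℕ) :
    PowerSeries.coeff 5 (twoLim ε z n) = 0 := coeff_twoLim_of_odd (by decide) ε z n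

lemma coeff_six_twoLim (ε : ℝ) (z : ℕ → ℝ) (n : ℕ) :
    PowerSeries.coeff 6 (twoLim ε z n) = -(2 * ε ^ n * z 6) :=
  coeff_twoLim_of_even (by decide) (by decide) ε z n

lemma coeff_zero_oneSqLim (z : ℕ → ℝ) (n : ℕ) :
    PowerSeries.coeff 0 (oneSqLim z n) = 1 := by simp [oneSqLim]

lemma coeff_one_oneSqLim (z : ℕ → ℝ) (n : ℕ) :
    PowerSeries.coeff 1 (oneSqLim z n) = 0 := by simp [oneSqLim]

lemma coeff_two_oneSqLim (z : ℕ → ℝ) (n : ℕ) :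
    PowerSeries.coeff 2 (oneSqLim z n) = powSum 1 2 n + z 2 := by
  simp [oneSqLim]; ring

lemma coeff_three_oneSqLim (z : ℕ → ℝ) (n : ℕ) :
    PowerSeries.coeff 3 (oneSqLim z n) = 2 * (z 3 - powSum 1 3 n) := by
  rw [oneSqLim, PowerSeries.coeff_mk, if_neg (by norm_num)]
  push_cast
  ring

lemma coeff_oneSqLim_zero {r : ℕ} (hr : r ≠ 0) (z : ℕ → ℝ) :
    PowerSeries.coeff r (oneSqLim z 0) = ((r : ℝ) - 1) * z r := by
  rw [oneSqLim, PowerSeries.coeff_mk, if_neg hr, powSum_zero]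
  rcases neg_one_pow_eq_or ℝ r with h | h <;> rw [h] <;> ring

lemma hasSum_eq_of_forall_eq {f g : ℕ → ℝ} {a b : ℝ} (hf : HasSum f a) (hg : HasSum g b)
    (h : ∀ n, f n = g n) : a = b :=
  hf.unique ((funext h : f = g) ▸ hg)

lemma hasSum_of_forall_eq {f g : ℕ → ℝ} {a b : ℝ} (hf : HasSum f a) (h : ∀ n, g n = f n)
    (hab : b = a) : HasSum g b := by
  rwa [hab, funext h]

/-! ### Double sums: evaluations and relations. -/

/-- Linear sums of weight five. -/
lemma zetaStar_four_one (h : RegLimit ε c z) (h₁ : RegLimit ε₁ c₁ z₁) (h₃ : RegLimit δ c₃ z₃)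
    (hδ : δ = ε * ε₁) :
    2 * zetaStar δ 4 ε₁ 1 = 2 * z₁ 1 * z₃ 4 + 4 * z₃ 5 + z 5 + z₁ 5 - 2 * z 2 * z₁ 3
      - 2 * z 4 * z₁ 1 := by
  -- As `s ^ 4` is even, `n + 1` and `-(n + 1)` give the same sum to leading order, whence the
  -- factor `2`. At `-(n + 1)` the partial sum lacks its last term, which produces `z 5`.
  have hk := hasSum_twoSided_mul h h₁
  have hs := ((((hasSum_zetaStar h₃.sq h₁.sq (p := 4) (by norm_num) 1).mul_left 2).sub
    ((h₃.hasSum (k := 4) (by norm_num)).mul_left (2 * z₁ 1))).sub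
    ((h₃.hasSum (k := 5) (by norm_num)).mul_left 4)).sub (h.hasSum (k := 5) (by norm_num))
  have e := hasSum_eq_of_forall_eq hs hk ?_
  · rw [show 1 + 4 = 5 from rfl, coeff_five_mul'] at e
    simp only [coeff_oneLim_zero, coeff_zero_oneLim, coeff_zero_twoLim, coeff_one_twoLim,
      coeff_two_twoLim, coeff_three_twoLim, coeff_four_twoLim, coeff_five_twoLim, ne_eq,
      OfNat.ofNat_ne_zero, one_ne_zero, not_false_eq_true, pow_zero] at e
    linear_combination e
  · intro n
    simp only [zetaStarTerm_eq, coeff_one_mul', coeff_zero_mul', coeff_zero_invSeries_pow,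
      coeff_one_invSeries_pow, coeff_zero_twoLim, coeff_one_twoLim, coeff_zero_oneLim,
      coeff_one_oneLim, coeff_zero_oneLimNeg, coeff_one_oneLimNeg, hδ, mul_pow]
    have hx : (n : ℝ) + 1 ≠ 0 := by positivity
    rcases mul_self_eq_one_iff.mp (pow_mul_pow_of_sq h₁.sq (n + 1)) with h1 | h1 <;> rw [h1] <;>
      field_simp <;> ring

/-- The square of one one-sided kernel over `s ^ m`: at `n` its sign is `(ε₁ ^ n) ^ 2 = 1`, so the
outer sum does not alternate. -/
lemma sq_zetaStar_one (h₁ : RegLimit ε₁ c₁ z₁) {m : ℕ} (hm : 3 ≤ m) (h₃ : RegLimit 1 c₃ z₃) :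
    2 * zetaStar 1 m ε₁ 1 = 2 * z₁ 1 * z₃ m + m * z₃ (m + 1)
      - PowerSeries.coeff (1 + m) (oneLim ε₁ z₁ 0 * oneLim ε₁ z₁ 0) := by
  have hk := hasSum_oneSided_mul h₁ h₁ hm
  have hs := (((hasSum_zetaStar h₃.sq h₁.sq hm 1).mul_left 2).sub
    ((h₃.hasSum (k := m) (by omega)).mul_left (2 * z₁ 1))).sub
    ((h₃.hasSum (k := m + 1) (by omega)).mul_left (m : ℝ))
  have e := hasSum_eq_of_forall_eq hs hk ?_
  · linear_combination e
  · intro n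
    simp only [zetaStarTerm_eq, coeff_one_mul', coeff_zero_mul', coeff_zero_invSeries_pow,
      coeff_one_invSeries_pow, coeff_zero_oneLim, coeff_one_oneLim, one_pow]
    have h1 := pow_mul_pow_of_sq h₁.sq (n + 1)
    linear_combination (-(2 * (powSum ε₁ 1 (n + 1) - z₁ 1) / ((n : ℝ) + 1) ^ m)
      + m / ((n : ℝ) + 1) ^ (m + 1)) * h1

lemma zetaStar_four_one_self (h₁ : RegLimit ε₁ c₁ z₁) (h₃ : RegLimit 1 c₃ z₃) :
    zetaStar 1 4 ε₁ 1 = z₁ 1 * z₃ 4 + 2 * z₃ 5 + z₁ 5 - z₁ 1 * z₁ 4 - z₁ 2 * z₁ 3 := by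
  have e := sq_zetaStar_one h₁ (m := 4) (by norm_num) h₃
  rw [show 1 + 4 = 5 from rfl, coeff_five_mul'] at e
  simp only [coeff_oneLim_zero, coeff_zero_oneLim, ne_eq,
      OfNat.ofNat_ne_zero, one_ne_zero, not_false_eq_true, pow_zero] at e
  push_cast at e
  linear_combination e / 2

lemma zetaStar_five_one_self (h₁ : RegLimit ε₁ c₁ z₁) (h₃ : RegLimit 1 c₃ z₃) :
    zetaStar 1 5 ε₁ 1 = z₁ 1 * z₃ 5 + 5 / 2 * z₃ 6 + z₁ 6 - z₁ 1 * z₁ 5 - z₁ 2 * z₁ 4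
      - z₁ 3 ^ 2 / 2 := by
  have e := sq_zetaStar_one h₁ (m := 5) (by norm_num) h₃
  rw [show 1 + 5 = 6 from rfl, coeff_six_mul'] at e
  simp only [coeff_oneLim_zero, coeff_zero_oneLim, ne_eq,
      OfNat.ofNat_ne_zero, one_ne_zero, not_false_eq_true, pow_zero] at e
  push_cast at e
  linear_combination e / 2

/-- Residues of `oneSidedSq * oneSided / s ^ 4`. For `ε₁ = -1` this ties `ζ*(4̄,2̄)` to `ζ*(4̄,2)`
and `ζ*(5̄,1̄)`. -/
lemma zetaStar_four_two_sub (h : RegLimit 1 c z) (h₁ : RegLimit ε₁ c₁ z₁) :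
    zetaStar ε₁ 4 1 2 - zetaStar ε₁ 4 ε₁ 2 - 4 * zetaStar ε₁ 5 ε₁ 1
      = z₁ 2 * z₁ 4 - z 2 * z₁ 4 - 4 * z₁ 1 * z₁ 5 - 10 * z₁ 6
        + z₁ 6 + z 2 * z₁ 4 + 2 * z 3 * z₁ 3 + 3 * z 4 * z₁ 2 + 4 * z 5 * z₁ 1 - 5 * z 6 := by
  have hk := hasSum_oneSidedSq_mul h h₁
  have hs := ((((hasSum_zetaStar h₁.sq h.sq (p := 4) (by norm_num) 2).sub
    (hasSum_zetaStar h₁.sq h₁.sq (p := 4) (by norm_num) 2)).sub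
    ((hasSum_zetaStar h₁.sq h₁.sq (p := 5) (by norm_num) 1).mul_left 4)).add
    ((h₁.hasSum (k := 4) (by norm_num)).mul_left (z 2 - z₁ 2))).add
    (((h₁.hasSum (k := 5) (by norm_num)).mul_left (4 * z₁ 1)).add
    ((h₁.hasSum (k := 6) (by norm_num)).mul_left 10))
  have e := hasSum_eq_of_forall_eq hs hk ?_
  · rw [show 2 + 4 = 6 from rfl, coeff_six_mul'] at e
    simp only [coeff_oneLim_zero, coeff_zero_oneLim, coeff_oneSqLim_zero, coeff_zero_oneSqLim, ne_eq,
      OfNat.ofNat_ne_zero, one_ne_zero, not_false_eq_true, pow_zero] at e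
    push_cast at e
    linear_combination e
  · intro n
    simp only [zetaStarTerm_eq, coeff_two_mul', coeff_one_mul', coeff_zero_mul',
      coeff_zero_invSeries_pow, coeff_one_invSeries_pow, coeff_two_invSeries_pow,
      coeff_zero_oneLim, coeff_one_oneLim, coeff_two_oneLim, coeff_zero_oneSqLim,
      coeff_one_oneSqLim, coeff_two_oneSqLim]
    push_cast
    ring

/-- By symmetry of the summand, the square of the simple sum counts the off-diagonal terms twice and
the diagonal once. -/
lemma zetaStar_three_three (h : RegLimit 1 c z) :
    2 * zetaStar 1 3 1 3 = z 3 ^ 2 + z 6 := by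
  have h1 : ∀ N, powSum 1 3 N ^ 2 + powSum 1 6 N
      = 2 * ∑ n ∈ range N, zetaStarTerm 1 3 1 3 n := fun N => by
    induction N with
    | zero => simp [powSum_zero]
    | succ N ih =>
      rw [sum_range_succ, mul_add, ← ih, zetaStarTerm_eq]
      simp only [powSum_succ, one_pow]
      field_simp
      ring
  have h2 := ((h.lim 3 (by norm_num)).pow 2).add (h.lim 6 (by norm_num))
  have h3 := ((hasSum_zetaStar h.sq h.sq (p := 3) le_rfl 3).tendsto_sum_nat).const_mul 2
  exact tendsto_nhds_unique h3 (h2.congr h1)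

/-- The kernel `oneSidedSq ^ 2 / s ^ 3` yields a combination of `ζ*(4,2)` and `ζ*(3,3)`; the latter
is known by symmetry. -/
lemma zetaStar_four_two (h : RegLimit 1 c z) :
    zetaStar 1 4 1 2 = z 3 ^ 2 - z 6 / 3 := by
  have hk := hasSum_oneSidedSq_mul_self h
  have hs := (((hasSum_zetaStar h.sq h.sq (p := 4) (by norm_num) 2).mul_left (-6)).sub
    ((hasSum_zetaStar h.sq h.sq (p := 3) (by norm_num) 3).mul_left 4)).add
    ((((h.hasSum (k := 3) (by norm_num)).mul_left (4 * z 3)).sub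
    ((h.hasSum (k := 4) (by norm_num)).mul_left (6 * z 2))).sub
    ((h.hasSum (k := 6) (by norm_num)).mul_left 10))
  have e := hasSum_eq_of_forall_eq hs hk ?_
  · rw [show 3 + 3 = 6 from rfl, coeff_six_mul'] at e
    simp only [coeff_oneSqLim_zero, coeff_zero_oneSqLim, ne_eq,
      OfNat.ofNat_ne_zero, one_ne_zero, not_false_eq_true] at e
    push_cast at e
    linear_combination -e / 6 - zetaStar_three_three h / 3
  · intro n
    simp only [zetaStarTerm_eq, coeff_three_mul', coeff_two_mul', coeff_one_mul', coeff_zero_mul',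
      coeff_zero_invSeries_pow, coeff_one_invSeries_pow, coeff_two_invSeries_pow,
      coeff_three_invSeries_pow, coeff_zero_oneSqLim,
      coeff_one_oneSqLim, coeff_two_oneSqLim, coeff_three_oneSqLim, one_pow]
    push_cast
    ring

lemma powSum_add_powSum_neg (r M : ℕ) :
    powSum 1 r (2 * M) + powSum (-1) r (2 * M) = 2 / 2 ^ r * powSum 1 r M := by
  rw [powSum_neg_one_two_mul]
  ring

/-- The distribution relation. -/
lemma zetaStar_distribution {p : ℕ} (hp : 3 ≤ p) (q : ℕ) :
    zetaStar 1 p 1 q + zetaStar 1 p (-1) q + zetaStar (-1) p 1 q + zetaStar (-1) p (-1) q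
      = 4 / 2 ^ (p + q) * zetaStar 1 p 1 q := by
  have h1 : (1 : ℝ) * 1 = 1 := by norm_num
  have h2 : (-1 : ℝ) * -1 = 1 := by norm_num
  have hs := (((hasSum_zetaStar h1 h1 hp q).add (hasSum_zetaStar h1 h2 hp q)).add
    (hasSum_zetaStar h2 h1 hp q)).add (hasSum_zetaStar h2 h2 hp q)
  have hinj : Function.Injective fun n : ℕ => 2 * n + 1 := fun a b h => by
    simp only at h; omega
  -- Adding both outer signs leaves only even `m`; index `2 * n + 1` stands for `m = 2 * (n + 1)`.
  -- Adding both inner signs likewise leaves the even inner indices.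
  have hsum := (hinj.hasSum_iff ?_).mpr hs
  · refine hasSum_eq_of_forall_eq hsum ((hasSum_zetaStar h1 h1 hp q).mul_left _) fun n => ?_
    have h3 : (-1 : ℝ) ^ (2 * n + 1 + 1) = 1 := by
      rw [show 2 * n + 1 + 1 = 2 * (n + 1) by ring, pow_mul]; norm_num
    have h4 := powSum_add_powSum_neg q (n + 1)
    have h5 : (((2 * n + 1 : ℕ) : ℝ) + 1) = 2 * ((n : ℝ) + 1) := by push_cast; ring
    simp only [Function.comp_apply, zetaStarTerm_eq, one_pow, h3, h5]
    rw [show 2 * n + 1 + 1 = 2 * (n + 1) by ring, mul_pow, pow_add]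
    have : (n : ℝ) + 1 ≠ 0 := by positivity
    linear_combination (2 / (2 ^ p * ((n : ℝ) + 1) ^ p)) * h4
  · intro n hn
    have hodd : Odd (n + 1) := by
      by_contra hc
      rw [Nat.not_odd_iff_even] at hc
      obtain ⟨k, hk⟩ := hc
      exact hn ⟨k - 1, by simp only; omega⟩
    simp only [zetaStarTerm_eq, one_pow, hodd.neg_one_pow]
    ring

/-! ### Reduction of quadratic sums to double sums. -/

/-- Quadratic sums of weight six. -/
lemma hasSum_quadratic (h : RegLimit ε c z) (h₁ : RegLimit ε₁ c₁ z₁) (h₂ : RegLimit ε₂ c₂ z₂)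
    (h₃ : RegLimit δ c₃ z₃) (h₄ : RegLimit δ₁ c₄ z₄) (h₅ : RegLimit δ₂ c₅ z₅)
    (hδ : δ = ε * ε₁ * ε₂) (hδ₁ : δ₁ = ε * ε₁) (hδ₂ : δ₂ = ε * ε₂) :
    HasSum (fun n : ℕ => δ ^ (n + 1) / ((n : ℝ) + 1) ^ 4
        * (powSum ε₁ 1 (n + 1) * powSum ε₂ 1 (n + 1)))
      (z₁ 1 * zetaStar δ 4 ε₂ 1 + z₂ 1 * zetaStar δ 4 ε₁ 1 - z₁ 1 * z₂ 1 * z₃ 4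
        + (zetaStar δ 4 ε₁ 2 + zetaStar δ 4 ε₂ 2) / 2 + (z₁ 2 + z₂ 2 + 2 * z 2) / 2 * z₃ 4
        + 2 * (zetaStar δ 5 ε₁ 1 + zetaStar δ 5 ε₂ 1) - 2 * (z₁ 1 + z₂ 1) * z₃ 5 - 5 * z₃ 6
        + (zetaStar δ₂ 5 ε₂ 1 + zetaStar δ₁ 5 ε₁ 1) / 2
        - z₂ 1 / 2 * z₅ 5 - z₁ 1 / 2 * z₄ 5 - z 6 / 2
        - PowerSeries.coeff 6 (twoLim ε z 0 * oneLim ε₁ z₁ 0 * oneLim ε₂ z₂ 0) / 2) := by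
  -- The quadratic term occurs equally at `n + 1` and `-(n + 1)`. The missing last terms at `-(n +
  -- 1)` cancel one sign `ε₁` or `ε₂`, which is where the signs `δ₂` and `δ₁` come from.
  have hk := (hasSum_twoSided_mul_mul h h₁ h₂).div_const 2
  have s4 : 3 ≤ 4 := by norm_num
  have s5 : 3 ≤ 5 := by norm_num
  have k4 : 2 ≤ 4 := by norm_num
  have k5 : 2 ≤ 5 := by norm_num
  have k6 : 2 ≤ 6 := by norm_num
  have hs := ((((hasSum_zetaStar h₃.sq h₂.sq s4 1).mul_left (z₁ 1)).add
    ((hasSum_zetaStar h₃.sq h₁.sq s4 1).mul_left (z₂ 1))).add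
    (((hasSum_zetaStar h₃.sq h₁.sq s4 2).add (hasSum_zetaStar h₃.sq h₂.sq s4 2)).div_const 2)).add
    ((((hasSum_zetaStar h₃.sq h₁.sq s5 1).add (hasSum_zetaStar h₃.sq h₂.sq s5 1)).mul_left 2).add
    (((hasSum_zetaStar h₅.sq h₂.sq s5 1).add (hasSum_zetaStar h₄.sq h₁.sq s5 1)).div_const 2))
  have hz := ((((h₃.hasSum k4).mul_left ((z₁ 2 + z₂ 2 + 2 * z 2) / 2 - z₁ 1 * z₂ 1)).sub
    ((h₃.hasSum k5).mul_left (2 * (z₁ 1 + z₂ 1)))).sub ((h₃.hasSum k6).mul_left 5)).sub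
    ((((h₅.hasSum k5).mul_left (z₂ 1 / 2)).add ((h₄.hasSum k5).mul_left (z₁ 1 / 2))).add
    ((h.hasSum k6).mul_left (1 / 2)))
  have ht := (hk.add hs).add hz
  rw [show 2 + 4 = 6 from rfl] at ht
  refine hasSum_of_forall_eq ht (fun n => ?_) ?_
  · simp only [zetaStarTerm_eq, coeff_two_mul', coeff_one_mul', coeff_zero_mul',
      coeff_zero_invSeries_pow, coeff_one_invSeries_pow, coeff_two_invSeries_pow,
      coeff_zero_twoLim, coeff_one_twoLim, coeff_two_twoLim, coeff_zero_oneLim, coeff_one_oneLim,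
      coeff_two_oneLim, coeff_zero_oneLimNeg, coeff_one_oneLimNeg, hδ, hδ₁, hδ₂, mul_pow]
    have hx : (n : ℝ) + 1 ≠ 0 := by positivity
    rcases mul_self_eq_one_iff.mp (pow_mul_pow_of_sq h₁.sq (n + 1)) with h1 | h1 <;>
      rcases mul_self_eq_one_iff.mp (pow_mul_pow_of_sq h₂.sq (n + 1)) with h2 | h2 <;>
      rw [h1, h2] <;> push_cast <;> field_simp <;> ring
  · ring

lemma coeff_six_zero_mul_mul (ε ε₁ ε₂ : ℝ) (z z₁ z₂ : ℕ → ℝ) :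
    PowerSeries.coeff 6 (twoLim ε z 0 * oneLim ε₁ z₁ 0 * oneLim ε₂ z₂ 0)
      = -z₁ 6 - z₂ 6 + z₁ 1 * z₂ 5 + z₁ 2 * z₂ 4 + z₁ 3 * z₂ 3 + z₁ 4 * z₂ 2 + z₁ 5 * z₂ 1
        - 2 * z 2 * (-z₁ 4 - z₂ 4 + z₁ 1 * z₂ 3 + z₁ 2 * z₂ 2 + z₁ 3 * z₂ 1)
        - 2 * z 4 * (-z₁ 2 - z₂ 2 + z₁ 1 * z₂ 1) - 2 * z 6 := by
  rw [mul_assoc, coeff_six_mul', coeff_five_mul', coeff_four_mul', coeff_three_mul',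
    coeff_two_mul', coeff_one_mul', coeff_zero_mul', coeff_six_mul']
  simp only [coeff_oneLim_zero, coeff_zero_oneLim, coeff_zero_twoLim, coeff_one_twoLim,
    coeff_two_twoLim, coeff_three_twoLim, coeff_four_twoLim, coeff_five_twoLim, coeff_six_twoLim,
    ne_eq, OfNat.ofNat_ne_zero, one_ne_zero, not_false_eq_true, pow_zero]
  ring

/-! ### Explicit values. -/

lemma zetaVal_eq_of_hasSum {k : ℕ} (hk : 2 ≤ k) {a : ℝ}
    (h : HasSum (fun n : ℕ => (1 : ℝ) / (n : ℝ) ^ k) a) : zetaVal k = a := by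
  have h2 := (hasSum_nat_add_iff' (f := fun n : ℕ => 1 / (n : ℝ) ^ k) 1).mpr h
  have hk0 : k ≠ 0 := by omega
  refine (zetaVal_spec hk).2.unique ?_
  simpa [hk0] using h2

lemma zetaVal_two : zetaVal 2 = Real.pi ^ 2 / 6 :=
  zetaVal_eq_of_hasSum (by norm_num) hasSum_zeta_two

lemma zetaVal_four : zetaVal 4 = Real.pi ^ 4 / 90 :=
  zetaVal_eq_of_hasSum (by norm_num) hasSum_zeta_four

lemma zetaVal_six : zetaVal 6 = Real.pi ^ 6 / 945 := by
  have h := hasSum_zeta_nat (k := 3) (by norm_num)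
  have hb : bernoulli 6 = 1 / 42 := by
    rw [bernoulli_eq_bernoulli'_of_ne_one (by norm_num), bernoulli'_def]
    have h5 : bernoulli' 5 = 0 := bernoulli'_eq_zero_of_odd (by decide) (by norm_num)
    norm_num [sum_range_succ, bernoulli'_four, h5, Nat.choose]
  refine (zetaVal_eq_of_hasSum (k := 6) (by norm_num) h).trans ?_
  rw [show 2 * 3 = 6 from rfl, hb]
  norm_num [Nat.factorial]
  ring

lemma zetaReg_one : zetaReg 1 = 0 := if_pos rfl
lemma zetaReg_of_ne {r : ℕ} (h : r ≠ 1) : zetaReg r = zetaVal r := if_neg h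
lemma altZeta_one : altZeta 1 = -Real.log 2 := if_pos rfl
lemma altZeta_of_ne {r : ℕ} (h : r ≠ 1) : altZeta r = (2 / 2 ^ r - 1) * zetaVal r := if_neg h

lemma altHarmonic_one (n : ℕ) : altHarmonic n 1 = -powSum (-1) 1 n := by
  rw [altHarmonic, powSum, ← sum_neg_distrib]
  refine sum_congr rfl fun i _ => ?_
  rw [pow_succ (-1 : ℝ)]
  ring

lemma altZeta_two : altZeta 2 = -(1 / 2) * zetaVal 2 := by
  rw [altZeta_of_ne (by norm_num)]; norm_num
lemma altZeta_three : altZeta 3 = -(3 / 4) * zetaVal 3 := by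
  rw [altZeta_of_ne (by norm_num)]; norm_num
lemma altZeta_four : altZeta 4 = -(7 / 8) * zetaVal 4 := by
  rw [altZeta_of_ne (by norm_num)]; norm_num
lemma altZeta_five : altZeta 5 = -(15 / 16) * zetaVal 5 := by
  rw [altZeta_of_ne (by norm_num)]; norm_num
lemma altZeta_six : altZeta 6 = -(31 / 32) * zetaVal 6 := by
  rw [altZeta_of_ne (by norm_num)]; norm_num

lemma zetaReg_two : zetaReg 2 = zetaVal 2 := zetaReg_of_ne (by norm_num)
lemma zetaReg_three : zetaReg 3 = zetaVal 3 := zetaReg_of_ne (by norm_num)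
lemma zetaReg_four : zetaReg 4 = zetaVal 4 := zetaReg_of_ne (by norm_num)
lemma zetaReg_five : zetaReg 5 = zetaVal 5 := zetaReg_of_ne (by norm_num)
lemma zetaReg_six : zetaReg 6 = zetaVal 6 := zetaReg_of_ne (by norm_num)

lemma zetaStar_four_one_one : zetaStar 1 4 1 1 = 3 * zetaVal 5 - zetaVal 2 * zetaVal 3 := by
  rw [zetaStar_four_one_self regLimit_one regLimit_one]
  simp only [zetaReg_one, zetaReg_two, zetaReg_three, zetaReg_five]
  ring

lemma zetaStar_four_neg_one : zetaStar 1 4 (-1) 1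
    = 17 / 16 * zetaVal 5 - 3 / 8 * zetaVal 2 * zetaVal 3
      - 15 / 8 * Real.log 2 * zetaVal 4 := by
  rw [zetaStar_four_one_self regLimit_neg_one regLimit_one]
  simp only [zetaReg_four, zetaReg_five, altZeta_one, altZeta_two, altZeta_three, altZeta_four,
    altZeta_five]
  ring

lemma zetaStar_neg_four_neg_one : zetaStar (-1) 4 (-1) 1
    = -(59 / 32) * zetaVal 5 + 3 / 4 * zetaVal 2 * zetaVal 3
      + 15 / 8 * Real.log 2 * zetaVal 4 := by
  have h := zetaStar_four_one regLimit_one regLimit_neg_one regLimit_neg_one (by norm_num)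
  simp only [zetaReg_two, zetaReg_four, zetaReg_five, altZeta_one, altZeta_three, altZeta_four,
    altZeta_five] at h
  linear_combination h / 2

lemma zetaStar_neg_four_one : zetaStar (-1) 4 1 1
    = -(59 / 32) * zetaVal 5 + 1 / 2 * zetaVal 2 * zetaVal 3 := by
  have h := zetaStar_four_one regLimit_neg_one regLimit_one regLimit_neg_one (by norm_num)
  simp only [zetaReg_one, zetaReg_three, zetaReg_five, altZeta_two, altZeta_five] at h
  linear_combination h / 2

lemma zetaStar_five_one : zetaStar 1 5 1 1
    = 7 / 2 * zetaVal 6 - zetaVal 2 * zetaVal 4 - zetaVal 3 ^ 2 / 2 := by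
  rw [zetaStar_five_one_self regLimit_one regLimit_one]
  simp only [zetaReg_one, zetaReg_two, zetaReg_three, zetaReg_four, zetaReg_six]
  ring

lemma zetaStar_five_neg_one : zetaStar 1 5 (-1) 1
    = 49 / 32 * zetaVal 6 - 31 / 16 * Real.log 2 * zetaVal 5 - 7 / 16 * zetaVal 2 * zetaVal 4
      - 9 / 32 * zetaVal 3 ^ 2 := by
  rw [zetaStar_five_one_self regLimit_neg_one regLimit_one]
  simp only [zetaReg_five, zetaReg_six, altZeta_one, altZeta_two, altZeta_three, altZeta_four,
    altZeta_five, altZeta_six]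
  ring

/-- Distribution in weight six: `4 / 2 ^ 6 - 1 = -15 / 16`. -/
lemma zetaStar_neg_five_neg_one : zetaStar (-1) 5 (-1) 1
    = -(15 / 16) * zetaStar 1 5 1 1 - zetaStar 1 5 (-1) 1 - zetaStar (-1) 5 1 1 := by
  have h := zetaStar_distribution (p := 5) (by norm_num) 1
  norm_num at h
  linear_combination h

lemma zetaStar_neg_four_neg_two : zetaStar (-1) 4 (-1) 2
    = zetaStar (-1) 4 1 2 - 4 * zetaStar (-1) 5 (-1) 1
      - (zetaVal 6 * (9 * 31 / 32 - 5) + zetaVal 2 * zetaVal 4 * (7 / 16 - 3 / 2)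
        - 3 / 2 * zetaVal 3 ^ 2 + Real.log 2 * zetaVal 5 * (-15 / 4 - 4)) := by
  have h := zetaStar_four_two_sub regLimit_one regLimit_neg_one
  simp only [zetaReg_two, zetaReg_three, zetaReg_four, zetaReg_five, zetaReg_six, altZeta_one,
    altZeta_two, altZeta_three, altZeta_four, altZeta_five, altZeta_six] at h
  linear_combination -h

lemma zetaStar_four_neg_two : zetaStar 1 4 (-1) 2
    = -(15 / 16) * zetaStar 1 4 1 2 - zetaStar (-1) 4 1 2 - zetaStar (-1) 4 (-1) 2 := by
  have h := zetaStar_distribution (p := 4) (by norm_num) 2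
  norm_num at h
  linear_combination h

lemma zetaStar_four_two_one : zetaStar 1 4 1 2 = zetaVal 3 ^ 2 - zetaVal 6 / 3 := by
  rw [zetaStar_four_two regLimit_one, zetaReg_three, zetaReg_six]

lemma pow_eq_neg_pow_succ (n : ℕ) : (-1 : ℝ) ^ n = -(-1) ^ (n + 1) := by
  rw [pow_succ]; ring

end EulerSum

open EulerSum in
theorem mainTheorem11 :
    HasSum (fun n : ℕ => (harmonic (n + 1) : ℝ) ^ 2 / ((n : ℝ) + 1) ^ 4 * (-1) ^ n)
      (-(175 / 32) * zetaVal 6 + 1 / 2 * zetaVal 3 ^ 2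
        - zetaStar (-1) 4 1 2 - 5 * zetaStar (-1) 5 1 1) ∧
    HasSum (fun n : ℕ => altHarmonic (n + 1) 1 ^ 2 / ((n : ℝ) + 1) ^ 4)
      (15 / 4 * Real.log 2 ^ 2 * zetaVal 4 + 9 / 4 * zetaVal 2 * zetaVal 3 * Real.log 2
        - 31 / 4 * zetaVal 5 * Real.log 2 + 231 / 64 * zetaVal 6 - 45 / 32 * zetaVal 3 ^ 2
        + zetaStar (-1) 5 (-1) 1 + zetaStar 1 4 (-1) 2) ∧
    HasSum (fun n : ℕ => altHarmonic (n + 1) 1 ^ 2 / ((n : ℝ) + 1) ^ 4 * (-1) ^ n)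
      (15 / 4 * Real.log 2 ^ 2 * zetaVal 4 + 9 / 4 * zetaVal 2 * zetaVal 3 * Real.log 2
        - 93 / 16 * zetaVal 5 * Real.log 2 + 35 / 64 * zetaVal 6 - 15 / 16 * zetaVal 3 ^ 2
        - zetaStar (-1) 4 1 2) ∧
    HasSum (fun n : ℕ =>
        (harmonic (n + 1) : ℝ) * altHarmonic (n + 1) 1 / ((n : ℝ) + 1) ^ 4)
      (-(3 / 2) * zetaVal 2 * zetaVal 3 * Real.log 2 + 31 / 8 * zetaVal 5 * Real.log 2
        + 2359 / 384 * zetaVal 6 - 7 / 64 * zetaVal 3 ^ 2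
        + 1 / 2 * zetaStar (-1) 5 (-1) 1 + 1 / 2 * zetaStar 1 4 (-1) 2
        + 2 * zetaStar (-1) 4 1 2 + 4 * zetaStar (-1) 5 1 1) ∧
    HasSum (fun n : ℕ =>
        (harmonic (n + 1) : ℝ) * altHarmonic (n + 1) 1 / ((n : ℝ) + 1) ^ 4 * (-1) ^ n)
      (-(3 / 2) * zetaVal 2 * zetaVal 3 * Real.log 2 + 155 / 32 * zetaVal 5 * Real.log 2
        + 7 / 64 * zetaVal 6 + 5 / 4 * zetaVal 3 ^ 2
        + zetaStar (-1) 4 1 2 + 3 / 2 * zetaStar (-1) 5 1 1) := by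
  have r := regLimit_one
  have s := regLimit_neg_one
  -- The sign of the two-sided kernel is forced: its product with the signs of the two harmonic sums
  -- must be the sign of the outer sum.
  have t₁ := hasSum_quadratic s r r s s s (by norm_num) (by norm_num) (by norm_num)
  have t₂ := hasSum_quadratic r s s r s s (by norm_num) (by norm_num) (by norm_num)
  have t₃ := hasSum_quadratic s s s s r r (by norm_num) (by norm_num) (by norm_num)
  have t₄ := hasSum_quadratic s r s r s r (by norm_num) (by norm_num) (by norm_num)
  have t₅ := hasSum_quadratic r r s s r s (by norm_num) (by norm_num) (by norm_num)
  -- An overall sign appears for each `altHarmonic` factor and for `(-1) ^ n` in place of `(-1) ^ (n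
  -- + 1)`; it survives in the first, third and fourth sums.
  refine ⟨hasSum_of_forall_eq t₁.neg (fun n => by
      simp only [← powSum_one_one, pow_eq_neg_pow_succ n]; ring) ?_,
    hasSum_of_forall_eq t₂ (fun n => by
      simp only [altHarmonic_one, one_pow]; ring) ?_,
    hasSum_of_forall_eq t₃.neg (fun n => by
      simp only [altHarmonic_one, pow_eq_neg_pow_succ n]; ring) ?_,
    hasSum_of_forall_eq t₄.neg (fun n => by
      simp only [← powSum_one_one, altHarmonic_one, one_pow]; ring) ?_,
    hasSum_of_forall_eq t₅ (fun n => by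
      simp only [← powSum_one_one, altHarmonic_one, pow_eq_neg_pow_succ n]; ring) ?_⟩
  all_goals
    -- All is reduced to `log 2`, `π`, `ζ(3)`, `ζ(5)`, `ζ*(4̄,2)` and `ζ*(5̄,1)`. Even zeta values
    -- become powers of `π`, so that `ζ(2)ζ(4)` and `ζ(2)^3` can be compared with `ζ(6)`.
    rw [coeff_six_zero_mul_mul]
    simp only [zetaReg_one, zetaReg_two, zetaReg_three, zetaReg_four, zetaReg_five, zetaReg_six,
      altZeta_one, altZeta_two, altZeta_three, altZeta_four, altZeta_five, altZeta_six,
      zetaStar_four_neg_two, zetaStar_neg_four_neg_two, zetaStar_neg_five_neg_one,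
      zetaStar_four_one_one, zetaStar_four_neg_one, zetaStar_neg_four_neg_one,
      zetaStar_neg_four_one, zetaStar_five_one, zetaStar_five_neg_one, zetaStar_four_two_one,
      zetaVal_two, zetaVal_four, zetaVal_six]
    ring
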